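/- All graphs are finite and simple. For a graph $G$ with adjacency matrix $A(G)$ and diagonal matrix of vertex degrees $D(G)$, and for $\alpha\in[0,1]$, put $A_\alpha(G)=\alpha D(G)+(1-\alpha)A(G)$; the largest eigenvalue of this real symmetric matrix is the $A_\alpha$-index $\lambda_\alpha(G)$ of $G$. The independence number of $G$ is the largest number of pairwise non-adjacent vertices of $G$. For integers $n\ge 1$ and $i\ge 1$ let $\mathcal G_{n,i}$ be the set of connected graphs on $n$ vertices with independence number $i$. Let $P_n$, $C_n$, $K_n$ and $K_{1,n-1}$ denote the path, cycle, complete graph and star on $n$ vertices, and for $n\ge 4$ let $T_{1,1,n-3}$ (the snake) be the $n$-vertex tree obtained from the disjoint union of two single vertices and a path $P_{n-3}$ by adding a new vertex adjacent to both single vertices and to one end vertex of the path. Theorem. Let $n\ge1$, $i\ge1$ and $\alpha\in[0,1)$. In each of the following cases the minimum of $\lambda_\alpha$ over $\mathcal G_{n,i}$ is attained, and, up to isomorphism, only by the graph indicated; that is, a graph $G$ on $n$ vertices belongs to $\mathcal G_{n,i}$ and satisfies $\lambda_\alpha(G)\le\lambda_\alpha(H)$ for all $H\in\mathcal G_{n,i}$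 if and only if $G$ is isomorphic to that graph. (i) If $i=1$: $K_n$. (ii) If $i=\lfloor n/2\rfloor$: $P_n$ when $n$ is even, and $C_n$ when $n$ is odd. (iii) If $i=\lceil n/2\rceil$: $P_n$. (iv) If $i=\lfloor n/2\rfloor+1$ and $n\ge 9$: $P_n$ when $n$ is odd, and $T_{1,1,n-3}$ when $n$ is even. (v) If $i=n-1$: $K_{1,n-1}$. -/

import Mathlib

/-- The matrix `A_α(G) = α D(G) + (1 - α) A(G)`, with `D(G)` the diagonal matrix of vertex degrees
and `A(G)` the adjacency matrix of `G`. -/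
noncomputable def aMatrix {n : ℕ} (α : ℝ) (G : SimpleGraph (Fin n)) :
    Matrix (Fin n) (Fin n) ℝ :=
  open Classical in α • G.degMatrix ℝ + (1 - α) • G.adjMatrix ℝ

/-- The `A_α`-index of `G`: the largest eigenvalue of `A_α(G)`
(for a matrix, the spectrum is the set of eigenvalues; see `isGreatest_aIndex`). -/
noncomputable def aIndex {n : ℕ} (α : ℝ) (G : SimpleGraph (Fin n)) : ℝ :=
  sSup (spectrum ℝ (aMatrix α G))

theorem aMatrix_isHermitian {n : ℕ} (α : ℝ) (G : SimpleGraph (Fin n)) :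
    (aMatrix α G).IsHermitian := by
  classical
  unfold aMatrix
  ext i j
  by_cases h : i = j
  · subst h; simp
  · simp [SimpleGraph.degMatrix, h, Ne.symm h, SimpleGraph.adj_comm]

/-- As soon as there is a vertex, the `A_α`-index is attained as the largest eigenvalue. -/
theorem isGreatest_aIndex {n : ℕ} (hn : 1 ≤ n) (α : ℝ) (G : SimpleGraph (Fin n)) :
    IsGreatest {μ : ℝ | Module.End.HasEigenvalue (Matrix.toLin' (aMatrix α G)) μ}
      (aIndex α G) := by
  have h : {μ : ℝ | Module.End.HasEigenvalue (Matrix.toLin' (aMatrix α G)) μ}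
      = spectrum ℝ (aMatrix α G) := by
    ext μ
    rw [Set.mem_ofPred_eq, Module.End.hasEigenvalue_iff_mem_spectrum, Matrix.spectrum_toLin']
  have hr := (aMatrix_isHermitian α G).spectrum_real_eq_range_eigenvalues
  have : Nonempty (Fin n) := ⟨⟨0, hn⟩⟩
  rw [h]
  have hfin : (spectrum ℝ (aMatrix α G)).Finite := hr ▸ Set.finite_range _
  have hne : (spectrum ℝ (aMatrix α G)).Nonempty := hr ▸ Set.range_nonempty _
  exact ⟨hne.csSup_mem hfin, fun x hx => le_csSup hfin.bddAbove hx⟩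

/-- The class `𝒢_{n,i}` of connected graphs with vertex set `{v_1, …, v_n}` and independence
number `i`. -/
def graphClass (n i : ℕ) : Set (SimpleGraph (Fin n)) :=
  {G | G.Connected ∧ G.indepNum = i}

/-- `G` belongs to `𝒢_{n,i}` and has minimum `A_α`-index in that class. -/
def IsMinimizer (α : ℝ) (n i : ℕ) (G : SimpleGraph (Fin n)) : Prop :=
  G ∈ graphClass n i ∧ ∀ H ∈ graphClass n i, aIndex α G ≤ aIndex α H

/-- The `T`-shaped tree `T_{a,b,c}`: a central vertex `none`, joined to the first vertex of each of
three disjoint paths `P_a`, `P_b`, `P_c`. -/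
def tTree (a b c : ℕ) : SimpleGraph (Option (Fin a ⊕ Fin b ⊕ Fin c)) :=
  SimpleGraph.fromRel fun x y =>
    match x, y with
    | none, some (.inl k) => k.val = 0
    | none, some (.inr (.inl k)) => k.val = 0
    | none, some (.inr (.inr k)) => k.val = 0
    | some (.inl j), some (.inl k) => j.val + 1 = k.val
    | some (.inr (.inl j)), some (.inr (.inl k)) => j.val + 1 = k.val
    | some (.inr (.inr j)), some (.inr (.inr k)) => j.val + 1 = k.val
    | _, _ => False

/-- The snake `T_{1,1,n-3}` of order `n` (for `n ≥ 4`). -/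
abbrev snake (n : ℕ) : SimpleGraph (Option (Fin 1 ⊕ Fin 1 ⊕ Fin (n - 3))) :=
  tTree 1 1 (n - 3)

/-! In cases (i) and (v) the class contains one graph up to isomorphism. The rest are index
comparisons.

Put s = α/(1-α), let L be the index divided by 1-α, and write L = t + 2s. Dividing the Perron
equation at u by x_u says that the loads s + x_z/x_u of the neighbours z of u add up to t + 2s at
every vertex. A subtree hanging at u loads u least when it is a pendant path (`Branch.pathLoad_le`);
that least load is `pathLoad`. Moving vertices from the shorter of two pendant paths to the longer
lowers their joint load (`pathLoad_shift`), because load increments are a constant divided by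
products of consecutive terms of `pathSeq`.

If G has a vertex v of degree at least 3, it is spanned by three branches at v, and shifting yields
that arms of sizes 1, 1, n-3 load v by at most t + 2s (`snake_load_le`). With the t of G, this makes
an explicit positive vector on the snake a supersolution, so the index of the snake is at most that
of G (`scaledIndex_le_of_super`, `snake_minimal`). Joining the arms end to end lowers the load
further, so the path lies strictly below. Tracing equality identifies the snake.

Connected graphs of maximum degree at most 2 are paths and cycles, so the path is least among all
connected graphs (`path_minimal`). For odd n and i = ⌊n/2⌋ trees are excluded by 2-colouring; the
degree sum is then at least 2n, and the all-ones Rayleigh quotient gives L ≥ 2/(1-α), with equality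
only for 2-regular graphs. For even n and i = n/2 + 1 paths and cycles have the wrong independence
number, so a vertex of degree at least 3 exists and the snake wins. -/

/-! ### Loads of pendant paths and the effect of shifting vertices -/

/-- Unnormalised load sequence of pendant paths: the solution of `u (k+2) = t u (k+1) - u k` with
`u 0 = 1` and `u 1 = t + s`. -/
def pathSeq (t s : ℝ) : ℕ → ℝ
  | 0 => 1
  | 1 => t + s
  | (k + 2) => t * pathSeq t s (k + 1) - pathSeq t s k

/-- The load which a pendant path with `m` vertices puts on its point of attachment. -/
noncomputable def pathLoad (t s : ℝ) : ℕ → ℝ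
  | 0 => 0
  | (m + 1) => s + pathSeq t s m / pathSeq t s (m + 1)

theorem pathSeq_add_two (t s : ℝ) (k : ℕ) :
    pathSeq t s (k + 2) = t * pathSeq t s (k + 1) - pathSeq t s k := rfl

/-- The recurrence has determinant 1, so this Casoratian keeps its value at k = 0. -/
theorem pathSeq_sq_sub (t s : ℝ) (k : ℕ) :
    pathSeq t s (k + 1) ^ 2 - pathSeq t s (k + 2) * pathSeq t s k = 1 + s * (t + s) := by
  induction k with
  | zero => simp [pathSeq]; ring
  | succ k ih =>
    rw [← ih, pathSeq_add_two t s (k + 1)]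
    have := pathSeq_add_two t s k
    rw [show k + 1 + 1 = k + 2 from rfl, this]
    ring

/-- Since the numerator is independent of k, comparing load increments reduces to comparing products
of consecutive terms. -/
theorem pathLoad_succ_sub (t s : ℝ) (k : ℕ) (h0 : 0 < pathSeq t s k)
    (h1 : 0 < pathSeq t s (k + 1)) :
    pathLoad t s (k + 1) - pathLoad t s k =
      (1 + s * (t + s)) / (pathSeq t s (k + 1) * pathSeq t s k) := by
  cases k with
  | zero =>
    simp only [pathSeq, pathLoad] at *
    field_simp
    ring
  | succ k =>
    rw [← pathSeq_sq_sub t s k]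
    simp only [pathLoad]
    rw [show k + 1 + 1 = k + 2 from rfl] at *
    field_simp
    ring

/-- The eigenvalue equation at the vertex carrying a pendant path: what the budget t + 2s leaves for
the next edge, less s, is the ratio of the next entry to this one. It transfers positivity one step
further. -/
theorem pathSeq_succ_eq (t s : ℝ) (b : ℕ) (hb : 0 < pathSeq t s b) :
    pathSeq t s (b + 1) = pathSeq t s b * (t + s - pathLoad t s b) := by
  cases b with
  | zero => simp [pathSeq, pathLoad]
  | succ b =>
    simp only [pathLoad]
    rw [pathSeq_add_two]
    field_simp
    ring

/-- The cross difference `u (b+1) u a - u (a-1) u b`, whose value depends on `a + b` only, controls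
the growth of `u` from `a` to `b`. -/
theorem pathSeq_le_of_cross (t s : ℝ) (d : ℕ) : ∀ a : ℕ,
    (∀ j ≤ a + 1 + d, 0 < pathSeq t s j) →
    0 < pathSeq t s (a + 1 + d + 1) * pathSeq t s (a + 1) - pathSeq t s a * pathSeq t s (a + 1 + d) →
    pathSeq t s (a + 1) ≤ pathSeq t s (a + 1 + d) := by
  induction d using Nat.strong_induction_on with
  | _ d ih =>
    intro a hpos hD
    rcases d with _ | _ | d
    · simp
    -- Adjacent indices: the cross difference equals u(a+2)² - u(a+1)².
    · have e1 := pathSeq_add_two t s (a + 1)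
      have e0 := pathSeq_add_two t s a
      have p1 := hpos (a + 1) (by omega)
      have p2 := hpos (a + 2) (by omega)
      simp only [Nat.zero_add] at *
      rw [show a + 1 + 1 + 1 = a + 1 + 2 from rfl, e1] at hD
      rw [show a + 1 + 1 = a + 2 from rfl] at *
      have : 0 < pathSeq t s (a + 2) ^ 2 - pathSeq t s (a + 1) ^ 2 := by
        have : pathSeq t s a = t * pathSeq t s (a + 1) - pathSeq t s (a + 2) := by linarith
        rw [this] at hD
        nlinarith
      nlinarith
    -- Both indices move inwards by one; the recurrence leaves the cross difference unchanged.
    · have hD' : 0 < pathSeq t s (a + 1 + 1 + d + 1) * pathSeq t s (a + 1 + 1) -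
          pathSeq t s (a + 1) * pathSeq t s (a + 1 + 1 + d) := by
        have e1 := pathSeq_add_two t s a
        have e2 := pathSeq_add_two t s (a + 1 + d + 1)
        rw [show a + 1 + (d + 1 + 1) + 1 = a + 1 + d + 1 + 2 by ring, e2,
          show a + 1 + (d + 1 + 1) = a + 1 + d + 1 + 1 by ring] at hD
        rw [show a + 1 + 1 + d + 1 = a + 1 + d + 1 + 1 by ring,
          show a + 1 + 1 + d = a + 1 + d + 1 by ring, show a + 1 + 1 = a + 2 from rfl, e1]
        linarith
      have h := ih d (by omega) (a + 1) (fun j hj => hpos j (by omega)) hD'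
      have p1 := hpos (a + 1) (by omega)
      have p2 := hpos (a + 2) (by omega)
      rw [show a + 1 + (d + 1 + 1) = a + 1 + 1 + d + 1 by ring]
      by_contra hcon
      push Not at hcon
      have p2' : 0 < pathSeq t s (a + 1 + 1) := p2
      nlinarith

/-- The claim amounts to u(a+1)u(a) < u(b+1)u(b). The load bound says u(a)/u(a+1) < u(b+1)/u(b),
which is positivity of the cross difference; `pathSeq_le_of_cross` then gives u(a+1) ≤ u(b), and the
two inequalities multiply. -/
theorem pathLoad_shift_one (t s : ℝ) (hs : 0 ≤ s) (a b : ℕ) (hab : a + 1 ≤ b)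
    (hpos : ∀ j ≤ b, 0 < pathSeq t s j)
    (hlt : pathLoad t s (a + 1) + pathLoad t s b < t + 2 * s) :
    0 < pathSeq t s (b + 1) ∧
      pathLoad t s a + pathLoad t s (b + 1) < pathLoad t s (a + 1) + pathLoad t s b := by
  have pa := hpos a (by omega)
  have pa1 := hpos (a + 1) (by omega)
  have pb := hpos b le_rfl
  have ga : pathLoad t s (a + 1) = s + pathSeq t s a / pathSeq t s (a + 1) := rfl
  have hq : 0 < pathSeq t s a / pathSeq t s (a + 1) := div_pos pa pa1
  have pb1 : 0 < pathSeq t s (b + 1) := by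
    rw [pathSeq_succ_eq t s b pb]
    exact mul_pos pb (by linarith)
  have ht : 0 < t + s := by
    have := hpos 1 (by omega)
    simpa [pathSeq] using this
  refine ⟨pb1, ?_⟩
  have h1 := pathLoad_succ_sub t s a pa pa1
  have h2 := pathLoad_succ_sub t s b pb pb1
  have hc : 0 < 1 + s * (t + s) := by positivity
  have hD : 0 < pathSeq t s (b + 1) * pathSeq t s (a + 1) - pathSeq t s a * pathSeq t s b := by
    have e := pathSeq_succ_eq t s b pb
    have : pathSeq t s a / pathSeq t s (a + 1) < t + s - pathLoad t s b := by linarith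
    rw [div_lt_iff₀ pa1] at this
    rw [e]
    nlinarith
  obtain ⟨d, rfl⟩ := Nat.exists_eq_add_of_le hab
  have hle := pathSeq_le_of_cross t s d a hpos hD
  have key : pathSeq t s (a + 1) * pathSeq t s a <
      pathSeq t s (a + 1 + d + 1) * pathSeq t s (a + 1 + d) := by
    have i1 : pathSeq t s a * pathSeq t s (a + 1 + d) * pathSeq t s (a + 1 + d) <
        pathSeq t s (a + 1 + d + 1) * pathSeq t s (a + 1) * pathSeq t s (a + 1 + d) :=
      mul_lt_mul_of_pos_right (by linarith) pb
    have i2 : pathSeq t s (a + 1) * pathSeq t s (a + 1) ≤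
        pathSeq t s (a + 1 + d) * pathSeq t s (a + 1 + d) := by gcongr
    have i3 := mul_le_mul_of_nonneg_left i2 pa.le
    have : pathSeq t s (a + 1) * (pathSeq t s (a + 1) * pathSeq t s a) <
      pathSeq t s (a + 1) * (pathSeq t s (a + 1 + d + 1) * pathSeq t s (a + 1 + d)) := by linarith
    exact lt_of_mul_lt_mul_left this pa1.le
  have := div_lt_div_of_pos_left hc (mul_pos pa1 pa) key
  linarith

/-- Each single shift lowers the total load, so the bound by t + 2s survives and the shift can be
iterated. -/
theorem pathLoad_shift (t s : ℝ) (hs : 0 ≤ s) (k : ℕ) : ∀ a b : ℕ, a + k ≤ b →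
    (∀ j ≤ b, 0 < pathSeq t s j) → pathLoad t s (a + k) + pathLoad t s b < t + 2 * s →
    (∀ j ≤ b + k, 0 < pathSeq t s j) ∧
      pathLoad t s a + pathLoad t s (b + k) ≤ pathLoad t s (a + k) + pathLoad t s b ∧
      (0 < k → pathLoad t s a + pathLoad t s (b + k) < pathLoad t s (a + k) + pathLoad t s b) := by
  induction k with
  | zero => intro a b _ hpos _; exact ⟨hpos, le_rfl, fun h => absurd h (lt_irrefl _)⟩
  | succ k ih =>
    intro a b hab hpos hlt
    obtain ⟨h1, h2⟩ := pathLoad_shift_one t s hs (a + k) b hab hpos hlt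
    have hpos' : ∀ j ≤ b + 1, 0 < pathSeq t s j := by
      intro j hj
      rcases Nat.lt_or_ge b j with h | h
      · rwa [show j = b + 1 by omega]
      · exact hpos j h
    obtain ⟨h3, h4, _⟩ := ih a (b + 1) (by omega) hpos' (h2.trans hlt)
    rw [show b + 1 + k = b + (k + 1) by ring] at *
    exact ⟨h3, h4.trans h2.le, fun _ => h4.trans_lt h2⟩

/-- Joining two pendant paths end to end lowers the load. -/
theorem pathLoad_add (t s : ℝ) (hs : 0 ≤ s) (a b : ℕ) (ha : ∀ j ≤ a, 0 < pathSeq t s j)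
    (hb : ∀ j ≤ b, 0 < pathSeq t s j) (hlt : pathLoad t s a + pathLoad t s b < t + 2 * s) :
    (∀ j ≤ a + b, 0 < pathSeq t s j) ∧
      pathLoad t s (a + b) ≤ pathLoad t s a + pathLoad t s b ∧
      (0 < a → 0 < b → pathLoad t s (a + b) < pathLoad t s a + pathLoad t s b) := by
  wlog h : a ≤ b generalizing a b
  · have := this b a hb ha (by linarith) (by omega)
    rw [Nat.add_comm b a, add_comm (pathLoad t s b)] at this
    exact ⟨this.1, this.2.1, fun x y => this.2.2 y x⟩
  -- The shorter path is emptied completely; an empty path carries load 0.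
  have := pathLoad_shift t s hs a 0 b (by omega) hb (by simpa using hlt)
  simp only [pathLoad, zero_add] at this
  rw [Nat.add_comm b a] at this
  exact ⟨this.1, this.2.1, fun x _ => this.2.2 x⟩

/-- Shortening one of two pendant paths to a single vertex lowers the load. -/
theorem pathLoad_one_add (t s : ℝ) (hs : 0 ≤ s) (a b : ℕ)
    (ha : ∀ j ≤ a + 1, 0 < pathSeq t s j) (hb : ∀ j ≤ b + 1, 0 < pathSeq t s j)
    (hlt : pathLoad t s (a + 1) + pathLoad t s (b + 1) < t + 2 * s) :
    (∀ j ≤ a + b + 1, 0 < pathSeq t s j) ∧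
      pathLoad t s 1 + pathLoad t s (a + b + 1) ≤ pathLoad t s (a + 1) + pathLoad t s (b + 1) ∧
      (0 < a → 0 < b →
        pathLoad t s 1 + pathLoad t s (a + b + 1) <
          pathLoad t s (a + 1) + pathLoad t s (b + 1)) := by
  wlog h : a ≤ b generalizing a b
  · have := this b a hb ha (by linarith) (by omega)
    rw [Nat.add_comm b a, add_comm (pathLoad t s (b + 1))] at this
    exact ⟨this.1, this.2.1, fun x y => this.2.2 y x⟩
  have := pathLoad_shift t s hs a 1 (b + 1) (by omega) hb (by rwa [Nat.add_comm 1 a])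
  rw [show b + 1 + a = a + b + 1 by ring, Nat.add_comm 1 a] at this
  exact ⟨this.1, this.2.1, fun x _ => this.2.2 x⟩

/-! ### Perron vectors and supersolutions -/

open Classical in
/-- The sum `∑ (s x_u + x_z)` over the neighbours `z` of `u`, which is the `u`-entry of
`A_α x / (1 - α)` when `s = α / (1 - α)`. -/
noncomputable def nbrSum {V : Type*} [Fintype V] (G : SimpleGraph V) (s : ℝ) (x : V → ℝ) (u : V) :
    ℝ := ∑ z, if G.Adj u z then s * x u + x z else 0

theorem aMatrix_mulVec_apply {n : ℕ} {α : ℝ} (hα1 : α < 1) (G : SimpleGraph (Fin n))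
    (x : Fin n → ℝ) (u : Fin n) :
    (aMatrix α G).mulVec x u = (1 - α) * nbrSum G (α / (1 - α)) x u := by
  classical
  have h : (1 - α) ≠ 0 := by linarith
  simp only [aMatrix, Matrix.add_mulVec, Matrix.smul_mulVec, Pi.add_apply, Pi.smul_apply,
    SimpleGraph.degMatrix_mulVec_apply, SimpleGraph.adjMatrix_mulVec_apply, smul_eq_mul, nbrSum]
  rw [← Finset.sum_filter, Finset.sum_add_distrib, ← SimpleGraph.neighborFinset_eq_filter,
    Finset.sum_const, nsmul_eq_mul]
  rw [SimpleGraph.card_neighborFinset_eq_degree]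
  field_simp

theorem nbrSum_iso {V W : Type*} [Fintype V] [Fintype W] {G : SimpleGraph V} {H : SimpleGraph W}
    (e : G ≃g H) (s : ℝ) (x : W → ℝ) (u : V) : nbrSum G s (x ∘ e) u = nbrSum H s x (e u) := by
  classical
  unfold nbrSum
  rw [← e.toEquiv.sum_comp]
  refine Finset.sum_congr rfl fun z _ => ?_
  have : H.Adj (e u) (e.toEquiv z) ↔ G.Adj u z := e.map_adj_iff
  simp only [this]
  rfl

theorem posSemidef_aIndex_smul_one_sub {n : ℕ} (hn : 1 ≤ n) (α : ℝ) (G : SimpleGraph (Fin n)) :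
    (aIndex α G • (1 : Matrix (Fin n) (Fin n) ℝ) - aMatrix α G).PosSemidef := by
  classical
  rw [Matrix.posSemidef_iff_isHermitian_and_spectrum_nonneg]
  refine ⟨?_, ?_⟩
  · exact (Matrix.isHermitian_one.smul (by simp [IsSelfAdjoint])).sub (aMatrix_isHermitian α G)
  · intro μ hμ
    have hmem : aIndex α G - μ ∈ spectrum ℝ (aMatrix α G) := by
      rw [spectrum.mem_iff] at hμ ⊢
      intro h
      apply hμ
      have : (algebraMap ℝ (Matrix (Fin n) (Fin n) ℝ)) μ -
          (aIndex α G • (1 : Matrix (Fin n) (Fin n) ℝ) - aMatrix α G) =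
          -((algebraMap ℝ (Matrix (Fin n) (Fin n) ℝ)) (aIndex α G - μ) - aMatrix α G) := by
        simp only [Algebra.algebraMap_eq_smul_one, sub_smul]
        abel
      rw [this]
      exact h.neg
    have := mem_upperBounds.1 (isGreatest_aIndex hn α G).2 (aIndex α G - μ) (by
      rw [Set.mem_ofPred_eq, Module.End.hasEigenvalue_iff_mem_spectrum, Matrix.spectrum_toLin']
      exact hmem)
    simp only [Set.mem_ofPred_eq]
    linarith

theorem aMatrix_apply_nonneg {n : ℕ} {α : ℝ} (hα1 : α < 1) (G : SimpleGraph (Fin n))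
    {i j : Fin n} (hij : i ≠ j) : 0 ≤ aMatrix α G i j := by
  classical
  simp only [aMatrix, SimpleGraph.degMatrix, Matrix.add_apply, Matrix.smul_apply,
    Matrix.diagonal_apply_ne _ hij, SimpleGraph.adjMatrix_apply]
  split_ifs <;> simp [hα1.le]

/-- Off the diagonal λI - A_α is nonpositive, so taking absolute values of an eigenvector does not
raise its quadratic form. The form is positive semidefinite, so it still vanishes, and its zeros are
kernel vectors. -/
theorem exists_nonneg_eigenvector {n : ℕ} (hn : 1 ≤ n) {α : ℝ} (hα1 : α < 1)
    (G : SimpleGraph (Fin n)) :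
    ∃ x : Fin n → ℝ, x ≠ 0 ∧ (∀ u, 0 ≤ x u) ∧ (aMatrix α G).mulVec x = aIndex α G • x := by
  classical
  obtain ⟨y, hy⟩ := (isGreatest_aIndex hn α G).1.exists_hasEigenvector
  have hy1 := hy.apply_eq_smul
  rw [Matrix.toLin'_apply] at hy1
  have hP := posSemidef_aIndex_smul_one_sub hn α G
  set M := aIndex α G • (1 : Matrix (Fin n) (Fin n) ℝ) - aMatrix α G with hM
  have hMv : ∀ z, M.mulVec z = aIndex α G • z - (aMatrix α G).mulVec z := by
    intro z; rw [hM, Matrix.sub_mulVec, Matrix.smul_mulVec, Matrix.one_mulVec]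
  refine ⟨fun u => |y u|, ?_, fun u => abs_nonneg _, ?_⟩
  · intro h
    apply hy.2
    ext u
    have := congrFun h u
    simpa using this
  · have hq : star (fun u => |y u|) ⬝ᵥ M.mulVec (fun u => |y u|) ≤ 0 := by
      have h0 : y ⬝ᵥ M.mulVec y = 0 := by rw [hMv, hy1]; simp
      rw [← h0]
      simp only [dotProduct, Matrix.mulVec, Finset.mul_sum, star_trivial]
      refine Finset.sum_le_sum fun i _ => Finset.sum_le_sum fun j _ => ?_
      by_cases hij : i = j
      · subst hij
        have : |y i| * |y i| = y i * y i := abs_mul_abs_self _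
        calc _ = M i i * (|y i| * |y i|) := by ring
          _ ≤ _ := by rw [this]; exact le_of_eq (by ring)
      · have hle : M i j ≤ 0 := by
          have := aMatrix_apply_nonneg hα1 G hij
          simp [hM, Matrix.one_apply_ne hij, this]
        have h2 : y i * y j ≤ |y i| * |y j| := by rw [← abs_mul]; exact le_abs_self _
        nlinarith
    have hz := (hP.dotProduct_mulVec_zero_iff _).1
      (le_antisymm hq (hP.dotProduct_mulVec_nonneg _))
    rw [hMv, sub_eq_zero] at hz
    exact hz.symm

/-- Propagation of a vertex property through a connected graph. -/
theorem forall_of_connected {V : Type*} {G : SimpleGraph V} (hG : G.Connected) {p : V → Prop}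
    (hp : ∀ u v, G.Adj u v → p u → p v) {u : V} (hu : p u) (v : V) : p v := by
  obtain ⟨w⟩ := hG.preconnected u v
  induction w with
  | nil => exact hu
  | cons h _ ih => exact ih (hp _ _ h hu)

/-- The `A_α`-index in the units of `nbrSum`. -/
noncomputable def scaledIndex {n : ℕ} (α : ℝ) (G : SimpleGraph (Fin n)) : ℝ :=
  aIndex α G / (1 - α)

theorem aIndex_le_iff {n : ℕ} {α : ℝ} (hα1 : α < 1) {G H : SimpleGraph (Fin n)} :
    aIndex α G ≤ aIndex α H ↔ scaledIndex α G ≤ scaledIndex α H := by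
  have : 0 < 1 - α := by linarith
  unfold scaledIndex
  rw [div_le_div_iff_of_pos_right this]

/-- Perron vector of a connected graph. -/
theorem exists_perron {n : ℕ} {α : ℝ} (hα1 : α < 1)
    {G : SimpleGraph (Fin n)} (hG : G.Connected) :
    ∃ x : Fin n → ℝ, (∀ u, 0 < x u) ∧
      ∀ u, nbrSum G (α / (1 - α)) x u = scaledIndex α G * x u := by
  classical
  have h1 : 0 < 1 - α := by linarith
  have hn : 1 ≤ n := by
    obtain ⟨v⟩ := hG.nonempty
    exact v.pos
  obtain ⟨x, hx0, hxn, hx⟩ := exists_nonneg_eigenvector hn hα1 G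
  have heq : ∀ u, nbrSum G (α / (1 - α)) x u = scaledIndex α G * x u := by
    intro u
    have := congrFun hx u
    rw [aMatrix_mulVec_apply hα1, Pi.smul_apply, smul_eq_mul] at this
    unfold scaledIndex
    field_simp
    linarith
  refine ⟨x, fun u => lt_of_le_of_ne (hxn u) fun h0 => hx0 ?_, heq⟩
  ext v
  -- Where x vanishes, the eigenvalue equation is a vanishing sum of nonnegative terms, so x
  -- vanishes at every neighbour.
  refine forall_of_connected hG (p := fun v => x v = 0) ?_ h0.symm v
  intro u v huv hu
  have := heq u
  rw [hu, mul_zero, nbrSum, Finset.sum_eq_zero_iff_of_nonneg] at this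
  · have := this v (Finset.mem_univ _)
    simpa [huv, hu] using this
  · intro z _
    split_ifs
    · simpa [hu] using hxn z
    · exact le_rfl

theorem sum_mul_nbrSum_comm {V : Type*} [Fintype V] (G : SimpleGraph V) (s : ℝ) (x y : V → ℝ) :
    ∑ u, x u * nbrSum G s y u = ∑ u, y u * nbrSum G s x u := by
  classical
  have : ∀ x y : V → ℝ, ∑ u, x u * nbrSum G s y u =
      (∑ u, ∑ z, if G.Adj u z then s * (x u * y u) else 0) +
        ∑ u, ∑ z, if G.Adj u z then x u * y z else 0 := by
    intro x y
    simp only [nbrSum, Finset.mul_sum, ← Finset.sum_add_distrib]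
    refine Finset.sum_congr rfl fun u _ => Finset.sum_congr rfl fun z _ => ?_
    split_ifs <;> ring
  rw [this, this]
  congr 1
  · simp only [mul_comm]
  · rw [Finset.sum_comm]
    refine Finset.sum_congr rfl fun u _ => Finset.sum_congr rfl fun z _ => ?_
    simp only [G.adj_comm, mul_comm]

/-- Collatz–Wielandt comparison: pair the supersolution with the positive Perron vector and use
symmetry; one strict inequality makes the pairing strict. -/
theorem scaledIndex_le_of_super {n : ℕ} {α : ℝ} (hα1 : α < 1)
    {G : SimpleGraph (Fin n)} (hG : G.Connected) {L : ℝ} {y : Fin n → ℝ} (hy : ∀ u, 0 < y u)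
    (hsup : ∀ u, nbrSum G (α / (1 - α)) y u ≤ L * y u) :
    scaledIndex α G ≤ L ∧
      ∀ u, nbrSum G (α / (1 - α)) y u < L * y u → scaledIndex α G < L := by
  obtain ⟨x, hx, hxe⟩ := exists_perron hα1 hG
  have := hG.nonempty
  have hS : 0 < ∑ u, x u * y u :=
    Finset.sum_pos (fun u _ => mul_pos (hx u) (hy u)) Finset.univ_nonempty
  have h1 : ∑ u, x u * nbrSum G (α / (1 - α)) y u = scaledIndex α G * ∑ u, x u * y u := by
    rw [sum_mul_nbrSum_comm, Finset.mul_sum]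
    exact Finset.sum_congr rfl fun u _ => by rw [hxe]; ring
  have h2 : ∑ u, x u * (L * y u) = L * ∑ u, x u * y u := by
    rw [Finset.mul_sum]
    exact Finset.sum_congr rfl fun u _ => by ring
  constructor
  · refine le_of_mul_le_mul_right ?_ hS
    rw [← h1, ← h2]
    exact Finset.sum_le_sum fun u _ => mul_le_mul_of_nonneg_left (hsup u) (hx u).le
  · intro u hu
    refine lt_of_mul_lt_mul_right ?_ hS.le
    rw [← h1, ← h2]
    exact Finset.sum_lt_sum (fun u _ => mul_le_mul_of_nonneg_left (hsup u) (hx u).le)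
      ⟨u, Finset.mem_univ _, mul_lt_mul_of_pos_left hu (hx u)⟩

open Classical in
theorem nbrSum_one {V : Type*} [Fintype V] (G : SimpleGraph V) (s : ℝ) (u : V) :
    nbrSum G s (fun _ => 1) u = (s + 1) * G.degree u := by
  simp only [nbrSum, mul_one, ← Finset.sum_filter, Finset.sum_const, nsmul_eq_mul]
  rw [← SimpleGraph.neighborFinset_eq_filter, SimpleGraph.card_neighborFinset_eq_degree, mul_comm]

theorem scaledIndex_iso {n : ℕ} {α : ℝ} (hα1 : α < 1) {G H : SimpleGraph (Fin n)}
    (hG : G.Connected) (e : G ≃g H) : scaledIndex α G = scaledIndex α H := by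
  have hH : H.Connected := e.connected_iff.1 hG
  have key : ∀ {G H : SimpleGraph (Fin n)}, G.Connected → H.Connected → (G ≃g H) →
      scaledIndex α G ≤ scaledIndex α H := by
    intro G H hG hH e
    obtain ⟨x, hx, hxe⟩ := exists_perron hα1 hH
    refine (scaledIndex_le_of_super hα1 hG (y := x ∘ e) (fun u => hx _) fun u => ?_).1
    rw [nbrSum_iso, hxe]; rfl
  exact le_antisymm (key hG hH e) (key hH hG e.symm)

open Classical in
/-- A connected graph whose degrees sum to at least `2n` has scaled index at least that of a cycle,
with equality only for 2-regular graphs. -/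
theorem le_scaledIndex_of_sum_degree {n : ℕ} {α : ℝ} (hα1 : α < 1)
    {G : SimpleGraph (Fin n)} (hG : G.Connected) (hm : 2 * n ≤ ∑ u, G.degree u) :
    2 / (1 - α) ≤ scaledIndex α G ∧
      (scaledIndex α G ≤ 2 / (1 - α) → ∀ u, G.degree u = 2) := by
  have h1 : 0 < 1 - α := by linarith
  obtain ⟨v⟩ := hG.nonempty
  have hn : 1 ≤ n := v.pos
  have hn' : (0 : ℝ) < n := by exact_mod_cast hn
  have hP := posSemidef_aIndex_smul_one_sub hn α G
  set M := aIndex α G • (1 : Matrix (Fin n) (Fin n) ℝ) - aMatrix α G with hM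
  have hMv : ∀ u, M.mulVec (fun _ => 1) u = aIndex α G - G.degree u := by
    intro u
    rw [hM, Matrix.sub_mulVec, Matrix.smul_mulVec, Matrix.one_mulVec, Pi.sub_apply,
      aMatrix_mulVec_apply hα1, nbrSum_one]
    simp only [Pi.smul_apply, smul_eq_mul]
    field_simp
    ring
  have hsum : star (fun _ => (1 : ℝ)) ⬝ᵥ M.mulVec (fun _ => 1) =
      n * aIndex α G - ((∑ u, G.degree u : ℕ) : ℝ) := by
    simp only [dotProduct, hMv, Pi.star_apply, star_one, one_mul, Finset.sum_sub_distrib,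
      Finset.sum_const, Finset.card_univ, Fintype.card_fin, nsmul_eq_mul]
    push_cast
    rfl
  have hm' : (2 * n : ℝ) ≤ ((∑ u, G.degree u : ℕ) : ℝ) := by exact_mod_cast hm
  have hge := hP.dotProduct_mulVec_nonneg (fun _ => 1)
  rw [hsum] at hge
  unfold scaledIndex
  rw [div_le_div_iff_of_pos_right h1, div_le_div_iff_of_pos_right h1]
  refine ⟨by nlinarith, fun hle u => ?_⟩
  -- In the equality case the all-ones vector is a zero of a semidefinite form, hence in its kernel,
  -- so every degree equals the index.
  have h0 : star (fun _ => (1 : ℝ)) ⬝ᵥ M.mulVec (fun _ => 1) = 0 := by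
    refine le_antisymm ?_ (hP.dotProduct_mulVec_nonneg _)
    rw [hsum]; nlinarith
  have hz := congrFun ((hP.dotProduct_mulVec_zero_iff _).1 h0) u
  rw [hMv, Pi.zero_apply] at hz
  have h2 : 2 ≤ aIndex α G := by nlinarith
  have : (G.degree u : ℝ) = 2 := by linarith
  exact_mod_cast this

/-! ### Rooted branches and lower bounds for their loads -/

/-- `Branch G S w`: the vertex set `S` is spanned by a tree of `G` with root `w`. -/
inductive Branch {V : Type*} [DecidableEq V] (G : SimpleGraph V) : Finset V → V → Prop
  | single (w : V) : Branch G {w} w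
  | graft {S T : Finset V} {w z : V} : Branch G S w → Branch G T z → Disjoint S T → G.Adj w z →
      Branch G (S ∪ T) w

namespace Branch

variable {V : Type*} [DecidableEq V] {G : SimpleGraph V}

theorem root_mem {S : Finset V} {w : V} (h : Branch G S w) : w ∈ S := by
  induction h with
  | single w => simp
  | graft _ _ _ _ ih _ => exact Finset.mem_union_left _ ih

/-- Grafting acts only at a root, so the new vertex is passed down to the piece that contains y, as
far as the singleton {y}. -/
theorem insert_vertex {S : Finset V} {w : V} (h : Branch G S w) {y z : V} (hy : y ∈ S)
    (hz : z ∉ S) (hyz : G.Adj y z) : Branch G (insert z S) w := by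
  induction h with
  | single w =>
    rw [Finset.mem_singleton] at hy
    subst hy
    have := graft (single y) (single z) (by simpa using Ne.symm (by simpa using hz)) hyz
    rwa [Finset.union_comm, ← Finset.insert_eq] at this
  | @graft S T w b h1 h2 hd hadj ih1 ih2 =>
    rw [Finset.mem_union, not_or] at hz
    rcases Finset.mem_union.1 hy with hy | hy
    · rw [← Finset.insert_union]
      exact graft (ih1 hy hz.1) h2 (by rw [Finset.disjoint_insert_left]; exact ⟨hz.2, hd⟩) hadj
    · rw [← Finset.union_insert]
      exact graft h1 (ih2 hy hz.2) (by rw [Finset.disjoint_insert_right]; exact ⟨hz.1, hd⟩) hadj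

end Branch

open Classical in
/-- The load on `w` from its neighbours in `S`. -/
noncomputable def load {V : Type*} (G : SimpleGraph V) (s : ℝ) (x : V → ℝ) (S : Finset V) (w : V) :
    ℝ := ∑ z ∈ S with G.Adj w z, (s + x z / x w)

section load

variable {V : Type*} {G : SimpleGraph V} {s : ℝ} {x : V → ℝ}

theorem load_union [DecidableEq V] {S T : Finset V} (h : Disjoint S T) (w : V) :
    load G s x (S ∪ T) w = load G s x S w + load G s x T w := by
  classical
  unfold load
  rw [Finset.filter_union, Finset.sum_union (Finset.disjoint_filter_filter h)]

theorem load_singleton_self (w : V) : load G s x {w} w = 0 := by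
  simp [load, Finset.filter_singleton]

theorem load_singleton {w z : V} (h : G.Adj w z) : load G s x {z} w = s + x z / x w := by
  simp [load, Finset.filter_singleton, h]

theorem load_nonneg (hs : 0 ≤ s) (hx : ∀ u, 0 < x u) (S : Finset V) (w : V) :
    0 ≤ load G s x S w :=
  Finset.sum_nonneg fun z _ => add_nonneg hs (div_pos (hx z) (hx w)).le

theorem load_pos (hs : 0 ≤ s) (hx : ∀ u, 0 < x u) {S : Finset V} {w z : V} (hz : z ∈ S)
    (hwz : G.Adj w z) : 0 < load G s x S w := by
  classical
  have : ∀ y, 0 < s + x y / x w := fun y => add_pos_of_nonneg_of_pos hs (div_pos (hx y) (hx w))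
  exact Finset.sum_pos (fun y _ => this y) ⟨z, by simp [hz, hwz]⟩

theorem load_mono [DecidableEq V] (hs : 0 ≤ s) (hx : ∀ u, 0 < x u) {S T : Finset V} (h : S ⊆ T) (w : V) :
    load G s x S w ≤ load G s x T w := by
  rw [← Finset.union_sdiff_of_subset h, load_union Finset.disjoint_sdiff]
  linarith [load_nonneg (G := G) hs hx (T \ S) w]

/-- Every edge carries positive load. This turns equality of loads into equality of neighbourhoods,
and drives the equality cases below. -/
theorem mem_of_load_le [DecidableEq V] (hs : 0 ≤ s) (hx : ∀ u, 0 < x u) {S T : Finset V} (h : S ⊆ T) {w : V}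
    (hle : load G s x T w ≤ load G s x S w) {z : V} (hz : z ∈ T) (hwz : G.Adj w z) : z ∈ S := by
  by_contra hzS
  rw [← Finset.union_sdiff_of_subset h, load_union Finset.disjoint_sdiff] at hle
  have := load_pos (S := T \ S) hs hx (by simp [hz, hzS]) hwz
  linarith

variable [Fintype V] [DecidableEq V]

open Classical in
/-- A branch `T` hanging from `w` by the edge `wz`, given a bound for the load on `z` in `T`. -/
theorem pathLoad_le_of_hanging {t : ℝ} (hs : 0 ≤ s) (hx : ∀ u, 0 < x u)
    {T : Finset V} {w z : V} (hz : z ∈ T) (hw : w ∉ T) (hwz : G.Adj w z)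
    (hsup : load G s x Finset.univ z ≤ t + 2 * s)
    (hT : load G s x T z < t + 2 * s →
      (∀ j ≤ T.card - 1, 0 < pathSeq t s j) ∧ pathLoad t s (T.card - 1) ≤ load G s x T z ∧
      (load G s x T z = pathLoad t s (T.card - 1) → {y ∈ T | G.Adj z y}.card ≤ 1 ∧
        ∀ u ∈ T, u ≠ z → G.degree u ≤ 2 ∧ G.degree u ≤ T.card - 1)) :
    (∀ j ≤ T.card, 0 < pathSeq t s j) ∧ pathLoad t s T.card ≤ load G s x T w ∧
      (load G s x T w = pathLoad t s T.card → {y ∈ T | G.Adj w y}.card = 1 ∧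
        ∀ u ∈ T, G.degree u ≤ 2 ∧ G.degree u ≤ T.card) := by
  obtain ⟨m, hm⟩ : ∃ m, T.card = m + 1 := ⟨T.card - 1, by
    have := Finset.card_pos.2 ⟨z, hz⟩; omega⟩
  rw [hm] at hT ⊢
  simp only [Nat.add_sub_cancel] at hT
  have hdj : Disjoint T {w} := by simpa using hw
  have hr : 0 < x w / x z := div_pos (hx w) (hx z)
  have hup : load G s x (T ∪ {w}) z ≤ load G s x Finset.univ z :=
    load_mono hs hx (Finset.subset_univ _) z
  have hsplit : load G s x (T ∪ {w}) z = load G s x T z + (s + x w / x z) := by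
    rw [load_union hdj, load_singleton hwz.symm]
  -- The edge from z back to w takes a positive share of the budget at z, so the load from T is
  -- strictly below it.
  obtain ⟨hpos, hle, heq⟩ := hT (by linarith)
  have pm := hpos m le_rfl
  have hsucc := pathSeq_succ_eq t s m pm
  have hr' : x w / x z ≤ t + s - pathLoad t s m := by linarith
  have pm1 : 0 < pathSeq t s (m + 1) := by
    rw [hsucc]; exact mul_pos pm (by linarith)
  have hzw : pathSeq t s m / pathSeq t s (m + 1) ≤ x z / x w := by
    have hd : 0 < t + s - pathLoad t s m := by linarith
    rw [hsucc, ← div_div, div_self pm.ne', one_div, ← inv_div (x w)]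
    exact inv_anti₀ hr hr'
  have hsub : load G s x {z} w ≤ load G s x T w :=
    load_mono hs hx (by simpa using hz) w
  rw [load_singleton hwz] at hsub
  have hg : pathLoad t s (m + 1) = s + pathSeq t s m / pathSeq t s (m + 1) := rfl
  refine ⟨fun j hj => ?_, by linarith, fun he => ?_⟩
  · rcases Nat.lt_or_ge m j with h | h
    · rwa [show j = m + 1 by omega]
    · exact hpos j h
  -- Equality forces z to be the only neighbour of w in T, and T together with w to exhaust the load
  -- on z.
  · have hzw' : x z / x w = pathSeq t s m / pathSeq t s (m + 1) := by linarith
    have hr'' : x w / x z = t + s - pathLoad t s m := by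
      rw [hsucc, ← div_div, div_self pm.ne', one_div, ← inv_div (x w)] at hzw'
      exact inv_injective hzw'
    obtain ⟨hc, hdeg⟩ := heq (by linarith)
    constructor
    · have : {y ∈ T | G.Adj w y} = {z} := by
        ext y
        simp only [Finset.mem_filter, Finset.mem_singleton]
        constructor
        · rintro ⟨hy, hwy⟩
          have := mem_of_load_le (S := {z}) hs hx (by simpa using hz)
            (by rw [load_singleton hwz]; linarith) hy hwy
          simpa using this
        · rintro rfl; exact ⟨hz, hwz⟩
      rw [this, Finset.card_singleton]
    -- The bound by the number of vertices matters for one-vertex branches: it makes that vertex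
    -- pendant in G.
    · intro u hu
      by_cases huz : u = z
      · subst huz
        have hN : G.neighborFinset u ⊆ insert w {y ∈ T | G.Adj u y} := by
          intro y hy
          rw [SimpleGraph.mem_neighborFinset] at hy
          have := mem_of_load_le (S := T ∪ {w}) hs hx (Finset.subset_univ _)
            (by rw [hsplit]; linarith) (Finset.mem_univ y) hy
          simp only [Finset.mem_union, Finset.mem_singleton, Finset.mem_insert,
            Finset.mem_filter] at this ⊢
          tauto
        have h1 := (Finset.card_le_card hN).trans (Finset.card_insert_le _ _)
        rw [SimpleGraph.card_neighborFinset_eq_degree] at h1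
        have h2 : {y ∈ T | G.Adj u y}.card < T.card :=
          Finset.card_lt_card ((Finset.filter_ssubset).2 ⟨u, hu, by simp⟩)
        omega
      · have := hdeg u hu huz
        omega

open Classical in
/-- Among all branches with a given number of vertices, pendant paths put the least load on their
root. -/
theorem Branch.pathLoad_le {t : ℝ} (hs : 0 ≤ s) (hx : ∀ u, 0 < x u)
    (hsup : ∀ u, load G s x Finset.univ u ≤ t + 2 * s) {S : Finset V} {w : V} (h : Branch G S w) :
    load G s x S w < t + 2 * s →
      (∀ j ≤ S.card - 1, 0 < pathSeq t s j) ∧ pathLoad t s (S.card - 1) ≤ load G s x S w ∧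
      (load G s x S w = pathLoad t s (S.card - 1) → {y ∈ S | G.Adj w y}.card ≤ 1 ∧
        ∀ u ∈ S, u ≠ w → G.degree u ≤ 2 ∧ G.degree u ≤ S.card - 1) := by
  induction h with
  | single w =>
    intro _
    refine ⟨fun j hj => ?_, ?_, fun _ => ⟨?_, ?_⟩⟩
    · have : j = 0 := by simpa using hj
      subst this
      simp [pathSeq]
    · simp [load_singleton_self, pathLoad]
    · exact (Finset.card_filter_le _ _).trans (by simp)
    · intro u hu hne
      exact absurd (Finset.mem_singleton.1 hu) hne
  | @graft S T w z h1 h2 hd hwz ih1 ih2 =>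
    intro hlt
    have hw : w ∉ T := Finset.disjoint_left.1 hd h1.root_mem
    obtain ⟨hposT, hleT, heqT⟩ := pathLoad_le_of_hanging hs hx h2.root_mem hw hwz (hsup z) ih2
    have hT0 : 0 < load G s x T w := load_pos hs hx h2.root_mem hwz
    rw [load_union hd] at hlt ⊢
    obtain ⟨hposS, hleS, heqS⟩ := ih1 (by linarith)
    have hS1 : 1 ≤ S.card := Finset.card_pos.2 ⟨w, h1.root_mem⟩
    have hT1 : 1 ≤ T.card := Finset.card_pos.2 ⟨z, h2.root_mem⟩
    obtain ⟨hp, hle, hst⟩ := pathLoad_add t s hs (S.card - 1) T.card hposS hposT (by linarith)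
    have hcard : (S ∪ T).card - 1 = S.card - 1 + T.card := by
      rw [Finset.card_union_of_disjoint hd]; omega
    rw [hcard]
    refine ⟨hp, by linarith, fun he => ?_⟩
    -- Joining two nonempty paths is strictly better and T is nonempty, so equality leaves only the
    -- root in S.
    have hS : S.card - 1 = 0 := by
      by_contra hne
      have := hst (by omega) (by omega)
      linarith
    have hSw : S = {w} := by
      obtain ⟨a, ha⟩ := Finset.card_eq_one.1 (show S.card = 1 by omega)
      have := h1.root_mem
      rw [ha, Finset.mem_singleton] at this
      rw [ha, this]
    obtain ⟨hc, hdeg⟩ := heqT (by linarith)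
    subst hSw
    constructor
    · rw [Finset.filter_union]
      refine (Finset.card_union_le _ _).trans ?_
      rw [hc, Finset.filter_singleton]
      simp
    · intro u hu hne
      rcases Finset.mem_union.1 hu with hu | hu
      · exact absurd (Finset.mem_singleton.1 hu) hne
      · have := hdeg u hu
        omega

end load

/-- A connected graph with a vertex `v` of degree at least three is spanned by three branches at
`v`, the first of which contains `v`. -/
theorem exists_three_branches {V : Type*} [Fintype V] [DecidableEq V] {G : SimpleGraph V}
    (hG : G.Connected) {v a b c : V} (hab : a ≠ b) (hac : a ≠ c) (hbc : b ≠ c) (ha : G.Adj v a)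
    (hb : G.Adj v b) (hc : G.Adj v c) :
    ∃ S B C : Finset V, Branch G S v ∧ Branch G B b ∧ Branch G C c ∧ a ∈ S ∧
      Disjoint S B ∧ Disjoint (S ∪ B) C ∧ S ∪ B ∪ C = Finset.univ := by
  classical
  let P : Finset V × Finset V × Finset V → Prop := fun q =>
    Branch G q.1 v ∧ Branch G q.2.1 b ∧ Branch G q.2.2 c ∧ a ∈ q.1 ∧
      Disjoint q.1 q.2.1 ∧ Disjoint (q.1 ∪ q.2.1) q.2.2
  have h0 : P ({v, a}, {b}, {c}) := by
    refine ⟨?_, .single b, .single c, by simp, ?_, ?_⟩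
    · have := (Branch.single (G := G) v).graft (.single a) (by simpa using ha.ne) ha
      exact this
    · simp [hb.ne', hab.symm]
    · simp [hc.ne', hac.symm, hbc.symm]
  -- Take disjoint branches covering as many vertices as possible. If a vertex were missed, some
  -- edge would leave the union, and its outer end could be added to one branch.
  obtain ⟨⟨S, B, C⟩, hP, hmax⟩ := Finset.exists_max_image (Finset.univ.filter P)
    (fun q => (q.1 ∪ q.2.1 ∪ q.2.2).card) ⟨_, Finset.mem_filter.2 ⟨Finset.mem_univ _, h0⟩⟩
  simp only [Finset.mem_filter, Finset.mem_univ, true_and] at hP hmax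
  obtain ⟨hS, hB, hC, haS, hd1, hd2⟩ := hP
  refine ⟨S, B, C, hS, hB, hC, haS, hd1, hd2, ?_⟩
  dsimp only at *
  rw [Finset.eq_univ_iff_forall]
  have key : ∀ q, P q → S ∪ B ∪ C ⊂ q.1 ∪ q.2.1 ∪ q.2.2 → False := fun q hq hss =>
    absurd (hmax q hq) (not_le.2 (Finset.card_lt_card hss))
  refine forall_of_connected hG (p := fun u => u ∈ S ∪ B ∪ C) (u := v) ?_
    (by simp [hS.root_mem])
  intro y z hyz hy
  by_contra hz
  have hz' : z ∉ S ∧ z ∉ B ∧ z ∉ C := by simpa [not_or, and_assoc] using hz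
  have hd2' := Finset.disjoint_union_left.1 hd2
  have hss : S ∪ B ∪ C ⊂ insert z (S ∪ B ∪ C) := Finset.ssubset_insert hz
  rcases Finset.mem_union.1 hy with hy | hy
  · rcases Finset.mem_union.1 hy with hy | hy
    · refine key (insert z S, B, C) ⟨hS.insert_vertex hy hz'.1 hyz, hB, hC,
        Finset.mem_insert_of_mem haS, ?_, ?_⟩ ?_
      · simp [hz', hd1]
      · simp [hz', hd2']
      · simpa [Finset.insert_union] using hss
    · refine key (S, insert z B, C) ⟨hS, hB.insert_vertex hy hz'.2.1 hyz, hC, haS, ?_, ?_⟩ ?_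
      · simp [hz', hd1]
      · simp [hz', hd2']
      · simpa [Finset.insert_union, Finset.union_insert] using hss
  · refine key (S, B, insert z C) ⟨hS, hB, hC.insert_vertex hy hz'.2.2 hyz, haS, hd1, ?_⟩ ?_
    · simp [hz', hd2']
    · simpa [Finset.insert_union, Finset.union_insert] using hss

open Classical in
/-- The load on a vertex of degree at least three is at least the one on the centre of the snake. -/
theorem snake_load_le {V : Type*} [Fintype V] {G : SimpleGraph V} (hG : G.Connected)
    {s t : ℝ} {x : V → ℝ} (hs : 0 ≤ s) (hx : ∀ u, 0 < x u)
    (hsup : ∀ u, load G s x Finset.univ u ≤ t + 2 * s) {v : V} (hv : 3 ≤ G.degree v) :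
    ∃ m, Fintype.card V = m + 4 ∧ (∀ j ≤ m + 1, 0 < pathSeq t s j) ∧
      2 * pathLoad t s 1 + pathLoad t s (m + 1) ≤ t + 2 * s ∧
      (2 * pathLoad t s 1 + pathLoad t s (m + 1) = t + 2 * s →
        (∀ u, u ≠ v → G.degree u ≤ 2) ∧ G.degree v = 3 ∧
        ∃ a b, a ≠ b ∧ G.Adj v a ∧ G.Adj v b ∧ G.degree a ≤ 1 ∧ G.degree b ≤ 1) := by
  rw [← SimpleGraph.card_neighborFinset_eq_degree] at hv
  obtain ⟨N, hN, hN3⟩ := Finset.exists_subset_card_eq hv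
  obtain ⟨a, b, c, hab, hac, hbc, rfl⟩ := Finset.card_eq_three.1 hN3
  have ha : G.Adj v a := by simpa using hN (by simp : a ∈ _)
  have hb : G.Adj v b := by simpa using hN (by simp : b ∈ _)
  have hc : G.Adj v c := by simpa using hN (by simp : c ∈ _)
  obtain ⟨S, B, C, hS, hB, hC, haS, hd1, hd2, hU⟩ :=
    exists_three_branches hG hab hac hbc ha hb hc
  have hd2' := Finset.disjoint_union_left.1 hd2
  have hvB : v ∉ B := Finset.disjoint_left.1 hd1 hS.root_mem
  have hvC : v ∉ C := Finset.disjoint_left.1 hd2'.1 hS.root_mem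
  have hload : load G s x S v + load G s x B v + load G s x C v ≤ t + 2 * s := by
    rw [← load_union hd1, ← load_union hd2, hU]
    exact hsup v
  have hB0 : 0 < load G s x B v := load_pos hs hx hB.root_mem hb
  have hC0 : 0 < load G s x C v := load_pos hs hx hC.root_mem hc
  obtain ⟨hSp, hSle, hSeq⟩ := hS.pathLoad_le hs hx hsup (by linarith)
  obtain ⟨hBp, hBle, hBeq⟩ := pathLoad_le_of_hanging hs hx hB.root_mem hvB hb (hsup b)
    (hB.pathLoad_le hs hx hsup)
  obtain ⟨hCp, hCle, hCeq⟩ := pathLoad_le_of_hanging hs hx hC.root_mem hvC hc (hsup c)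
    (hC.pathLoad_le hs hx hsup)
  -- S contains its root v as well as a, so it competes with a pendant path of p + 1 ≥ 1 vertices.
  obtain ⟨p, hp⟩ : ∃ p, S.card = p + 2 := ⟨S.card - 2, by
    have : ({v, a} : Finset V).card ≤ S.card := Finset.card_le_card (by
      intro y; simp only [Finset.mem_insert, Finset.mem_singleton]
      rintro (rfl | rfl)
      exacts [hS.root_mem, haS])
    rw [Finset.card_pair ha.ne] at this
    omega⟩
  obtain ⟨q, hq⟩ : ∃ q, B.card = q + 1 := ⟨B.card - 1, by
    have := Finset.card_pos.2 ⟨b, hB.root_mem⟩; omega⟩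
  obtain ⟨r, hr⟩ : ∃ r, C.card = r + 1 := ⟨C.card - 1, by
    have := Finset.card_pos.2 ⟨c, hC.root_mem⟩; omega⟩
  have hcard : Fintype.card V = p + q + r + 4 := by
    rw [← Finset.card_univ, ← hU, Finset.card_union_of_disjoint hd2,
      Finset.card_union_of_disjoint hd1, hp, hq, hr]
    ring
  rw [hp, show p + 2 - 1 = p + 1 by omega] at hSp hSle hSeq
  rw [hq] at hBp hBle hBeq
  rw [hr] at hCp hCle hCeq
  have g0 : ∀ k, (∀ j ≤ k + 1, 0 < pathSeq t s j) → 0 < pathLoad t s (k + 1) := fun k hk =>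
    add_pos_of_nonneg_of_pos hs (div_pos (hk k (by omega)) (hk _ le_rfl))
  have gS := g0 p hSp
  have gB := g0 q hBp
  have gC := g0 r hCp
  -- Two shifts take the arms (p+1, q+1, r+1) to (1, p+q+1, r+1) and then to (1, 1, p+q+r+1).
  obtain ⟨h1p, h1le, h1st⟩ := pathLoad_one_add t s hs p q hSp hBp (by linarith)
  have g1 := g0 0 (fun j hj => hSp j (by omega))
  simp only [zero_add] at g1
  obtain ⟨h2p, h2le, h2st⟩ := pathLoad_one_add t s hs (p + q) r h1p hCp (by linarith)
  refine ⟨p + q + r, hcard, h2p, by linarith, fun he => ?_⟩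
  -- Equality makes neither shift strict, so at least two of p, q, r vanish; these give the two
  -- pendant neighbours of v.
  have n1 : p = 0 ∨ q = 0 := by
    by_contra hne
    push Not at hne
    have := h1st (by omega) (by omega)
    linarith
  have n2 : p + q = 0 ∨ r = 0 := by
    by_contra hne
    push Not at hne
    have := h2st (by omega) (by omega)
    linarith
  obtain ⟨hS1, hS2⟩ := hSeq (by linarith)
  obtain ⟨hB1, hB2⟩ := hBeq (by linarith)
  obtain ⟨hC1, hC2⟩ := hCeq (by linarith)
  refine ⟨fun u hu => ?_, ?_, ?_⟩
  · have : u ∈ S ∪ B ∪ C := by rw [hU]; exact Finset.mem_univ _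
    simp only [Finset.mem_union] at this
    rcases this with (h | h) | h
    exacts [(hS2 u h hu).1, (hB2 u h).1, (hC2 u h).1]
  · refine le_antisymm ?_ (by rwa [SimpleGraph.card_neighborFinset_eq_degree] at hv)
    rw [← SimpleGraph.card_neighborFinset_eq_degree, SimpleGraph.neighborFinset_eq_filter, ← hU,
      Finset.filter_union, Finset.filter_union]
    have e1 := Finset.card_union_le (({y ∈ S | G.Adj v y}) ∪ {y ∈ B | G.Adj v y})
      {y ∈ C | G.Adj v y}
    have e2 := Finset.card_union_le ({y ∈ S | G.Adj v y}) {y ∈ B | G.Adj v y}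
    omega
  · have da : p = 0 → G.degree a ≤ 1 := fun h => by
      have := (hS2 a haS ha.ne').2; omega
    have db : q = 0 → G.degree b ≤ 1 := fun h => by
      have := (hB2 b hB.root_mem).2; omega
    have dc : r = 0 → G.degree c ≤ 1 := fun h => by
      have := (hC2 c hC.root_mem).2; omega
    rcases n1 with h1 | h1
    · rcases n2 with h2 | h2
      · exact ⟨a, b, hab, ha, hb, da h1, db (by omega)⟩
      · exact ⟨a, c, hac, ha, hc, da h1, dc h2⟩
    · rcases n2 with h2 | h2
      · exact ⟨a, b, hab, ha, hb, da (by omega), db h1⟩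
      · exact ⟨b, c, hbc, hb, hc, db h1, dc h2⟩

/-! ### Connected graphs of maximum degree at most two -/

open Classical in
/-- A connected graph of maximum degree at most two has a Hamiltonian path, and its only possible
further edge joins the ends of that path. -/
theorem exists_hamiltonian_enumeration {V : Type*} [Fintype V] {G : SimpleGraph V}
    (hG : G.Connected) (hdeg : ∀ u, G.degree u ≤ 2) :
    ∃ f : Fin (Fintype.card V) ≃ V, (∀ i j, i.val + 1 = j.val → G.Adj (f i) (f j)) ∧
      ∀ i j, i < j → G.Adj (f i) (f j) →
        i.val + 1 = j.val ∨ (i.val = 0 ∧ j.val + 1 = Fintype.card V) := by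
  have := hG.nonempty
  -- In a longest path the ends have no neighbours outside by maximality, and the inner vertices
  -- none by the degree bound, so connectedness makes it Hamiltonian.
  obtain ⟨u, v, p, hp, hmax⟩ := SimpleGraph.Walk.exists_isPath_forall_isPath_length_le_length G
  have hsucc : ∀ i < p.length, G.Adj (p.getVert i) (p.getVert (i + 1)) :=
    fun i hi => p.adj_getVert_succ hi
  have hinj : ∀ i ≤ p.length, ∀ j ≤ p.length, p.getVert i = p.getVert j → i = j :=
    fun i hi j hj h => hp.getVert_injOn hi hj h
  have hint : ∀ i, 0 < i → i < p.length → ∀ y, G.Adj (p.getVert i) y →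
      y = p.getVert (i - 1) ∨ y = p.getVert (i + 1) := by
    intro i hi hil y hy
    by_contra hne
    push Not at hne
    have h1 : G.Adj (p.getVert i) (p.getVert (i - 1)) := by
      have := hsucc (i - 1) (by omega)
      rw [Nat.sub_add_cancel hi] at this
      exact this.symm
    have hne' : p.getVert (i - 1) ≠ p.getVert (i + 1) := fun h => by
      have := hinj _ (by omega) _ (by omega) h
      omega
    have hsub : {y, p.getVert (i - 1), p.getVert (i + 1)} ⊆ G.neighborFinset (p.getVert i) := by
      intro z
      simp only [Finset.mem_insert, Finset.mem_singleton, SimpleGraph.mem_neighborFinset]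
      rintro (rfl | rfl | rfl)
      exacts [hy, h1, hsucc i hil]
    have := Finset.card_le_card hsub
    rw [Finset.card_eq_three.2 ⟨_, _, _, hne.1, hne.2, hne', rfl⟩,
      SimpleGraph.card_neighborFinset_eq_degree] at this
    have := hdeg (p.getVert i)
    omega
  have hstart : ∀ y, G.Adj u y → y ∈ p.support := by
    intro y hy
    by_contra hys
    have := hmax _ _ (p.cons hy.symm) (hp.cons hys)
    simp at this
  have hend : ∀ y, G.Adj v y → y ∈ p.support := by
    intro y hy
    by_contra hys
    have := hmax _ _ (p.concat hy) (hp.concat hys hy)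
    simp at this
  have hall : ∀ y, y ∈ p.support := by
    refine forall_of_connected hG (p := fun y => y ∈ p.support) ?_ p.start_mem_support
    intro y z hyz hy
    obtain ⟨i, rfl, hi⟩ := SimpleGraph.Walk.mem_support_iff_exists_getVert.1 hy
    rcases Nat.eq_zero_or_pos i with rfl | h0
    · exact hstart z (by simpa using hyz)
    rcases hi.lt_or_eq with h1 | rfl
    · rcases hint i h0 h1 z hyz with rfl | rfl <;> exact p.getVert_mem_support _
    · exact hend z (by simpa using hyz)
  have hbij : Function.Bijective (fun i : Fin (p.length + 1) => p.getVert i.val) := by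
    constructor
    · intro i j hij
      exact Fin.ext (hinj _ (by omega) _ (by omega) hij)
    · intro y
      obtain ⟨i, rfl, hi⟩ := SimpleGraph.Walk.mem_support_iff_exists_getVert.1 (hall y)
      exact ⟨⟨i, by omega⟩, rfl⟩
  have hcard : Fintype.card V = p.length + 1 := by
    rw [← Fintype.card_of_bijective hbij, Fintype.card_fin]
  rw [hcard]
  refine ⟨Equiv.ofBijective _ hbij, ?_, ?_⟩
  · intro i j hij
    simp only [Equiv.ofBijective_apply, ← hij]
    exact hsucc _ (by omega)
  · intro i j hij hadj
    have hlt : i.val < j.val := hij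
    simp only [Equiv.ofBijective_apply] at hadj
    rcases Nat.eq_zero_or_pos i.val with h0 | h0
    · rcases Nat.lt_or_ge j.val p.length with h1 | h1
      · left
        rcases hint j.val (by omega) h1 _ hadj.symm with h | h
        · have := hinj _ (by omega) _ (by omega) h; omega
        · have := hinj _ (by omega) _ (by omega) h; omega
      · right; omega
    · left
      rcases hint i.val h0 (by omega) _ hadj with h | h
      · have := hinj _ (by omega) _ (by omega) h; omega
      · have := hinj _ (by omega) _ (by omega) h; omega

theorem cycleGraph_adj_of_lt {n : ℕ} {i j : Fin n} (h : i < j) :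
    (SimpleGraph.cycleGraph n).Adj i j ↔ i.val + 1 = j.val ∨ (i.val = 0 ∧ j.val + 1 = n) := by
  have h' : i.val < j.val := h
  have hj := j.isLt
  rw [SimpleGraph.cycleGraph_adj', Fin.coe_sub_iff_lt.2 h, Fin.coe_sub_iff_le.2 h.le]
  omega

/-- An equivalence preserving adjacency of pairs `i < j` is a graph isomorphism. -/
def isoOfLt {n : ℕ} {V : Type*} {H : SimpleGraph (Fin n)} {G : SimpleGraph V} (f : Fin n ≃ V)
    (h : ∀ i j, i < j → (G.Adj (f i) (f j) ↔ H.Adj i j)) : H ≃g G where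
  toEquiv := f
  map_rel_iff' := by
    intro i j
    rcases lt_trichotomy i j with hij | rfl | hij
    · exact h i j hij
    · simp
    · rw [G.adj_comm, H.adj_comm]; exact h j i hij

theorem pathGraph_adj_of_lt {n : ℕ} {i j : Fin n} (h : i < j) :
    (SimpleGraph.pathGraph n).Adj i j ↔ i.val + 1 = j.val := by
  have h' : i.val < j.val := h
  rw [SimpleGraph.pathGraph_adj]
  omega

open Classical in
theorem path_or_cycle {V : Type*} [Fintype V] {G : SimpleGraph V}
    (hG : G.Connected) (hdeg : ∀ u, G.degree u ≤ 2) :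
    Nonempty (SimpleGraph.pathGraph (Fintype.card V) ≃g G) ∨
      (3 ≤ Fintype.card V ∧ Nonempty (SimpleGraph.cycleGraph (Fintype.card V) ≃g G)) := by
  obtain ⟨f, h1, h2⟩ := exists_hamiltonian_enumeration hG hdeg
  by_cases hc : 3 ≤ Fintype.card V ∧ ∃ i j : Fin (Fintype.card V), i.val = 0 ∧
      j.val + 1 = Fintype.card V ∧ G.Adj (f i) (f j)
  · obtain ⟨h3, i0, j0, hi0, hj0, hadj⟩ := hc
    refine .inr ⟨h3, ⟨isoOfLt f fun i j hij => ?_⟩⟩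
    rw [cycleGraph_adj_of_lt hij]
    refine ⟨h2 i j hij, ?_⟩
    rintro (h | ⟨hi, hj⟩)
    · exact h1 i j h
    · rwa [show i = i0 from Fin.ext (by omega), show j = j0 from Fin.ext (by omega)]
  · refine .inl ⟨isoOfLt f fun i j hij => ?_⟩
    have h' : i.val < j.val := hij
    rw [pathGraph_adj_of_lt hij]
    refine ⟨fun hadj => ?_, h1 i j⟩
    rcases h2 i j hij hadj with h | ⟨hi, hj⟩
    · exact h
    · have : ¬ 3 ≤ Fintype.card V := fun h3 => hc ⟨h3, i, j, hi, hj, hadj⟩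
      omega

theorem two_le_degree {V : Type*} {G : SimpleGraph V} {u y z : V} [Fintype (G.neighborSet u)]
    (hyz : y ≠ z) (hy : G.Adj u y) (hz : G.Adj u z) : 2 ≤ G.degree u := by
  classical
  rw [← SimpleGraph.card_neighborFinset_eq_degree, ← Finset.card_pair hyz]
  refine Finset.card_le_card fun w => ?_
  simp only [Finset.mem_insert, Finset.mem_singleton, SimpleGraph.mem_neighborFinset]
  rintro (rfl | rfl) <;> assumption

open Classical in
/-- A connected graph of maximum degree at most two with a pendant vertex `b` is a path starting
at `b`. -/
theorem exists_path_iso_of_leaf {V : Type*} [Fintype V] {G : SimpleGraph V}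
    (hG : G.Connected) (hdeg : ∀ u, G.degree u ≤ 2) {b : V} (hb : G.degree b ≤ 1) :
    ∃ e : SimpleGraph.pathGraph (Fintype.card V) ≃g G, ∀ i, i.val = 0 → e i = b := by
  have key : ∃ f : Fin (Fintype.card V) ≃ V, (∀ i, i.val = 0 → f i = b) ∧
      (∀ i j, i.val + 1 = j.val → G.Adj (f i) (f j)) ∧
      ∀ i j, i < j → G.Adj (f i) (f j) →
        i.val + 1 = j.val ∨ (i.val = 0 ∧ j.val + 1 = Fintype.card V) := by
    -- A vertex of degree at most 1 is not interior to the enumeration; if it comes last, the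
    -- enumeration is reversed.
    obtain ⟨f, h1, h2⟩ := exists_hamiltonian_enumeration hG hdeg
    obtain ⟨k, rfl⟩ := f.surjective b
    by_cases h0 : k.val = 0
    · exact ⟨f, fun i hi => by rw [show i = k from Fin.ext (by omega)], h1, h2⟩
    by_cases hl : k.val + 1 = Fintype.card V
    · refine ⟨Fin.revPerm.trans f, fun i hi => ?_, fun i j hij => ?_, fun i j hij hadj => ?_⟩
      · have : Fin.rev i = k := Fin.ext (by rw [Fin.val_rev]; omega)
        simp [this]
      · exact (h1 (Fin.rev j) (Fin.rev i) (by rw [Fin.val_rev, Fin.val_rev]; omega)).symm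
      · have := h2 (Fin.rev j) (Fin.rev i) (Fin.rev_lt_rev.2 hij) hadj.symm
        rw [Fin.val_rev, Fin.val_rev] at this
        omega
    · have hk := k.isLt
      have e1 := h1 ⟨k.val - 1, by omega⟩ k (Nat.sub_add_cancel (by omega))
      have e2 := h1 k ⟨k.val + 1, by omega⟩ rfl
      have := two_le_degree (fun h => by
        have := congrArg Fin.val (f.injective h)
        simp only at this
        omega) e1.symm e2
      omega
  obtain ⟨f, h0, h1, h2⟩ := key
  refine ⟨isoOfLt f fun i j hij => ?_, h0⟩
  rw [pathGraph_adj_of_lt hij]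
  have h' : i.val < j.val := hij
  refine ⟨fun hadj => ?_, h1 i j⟩
  rcases h2 i j hij hadj with h | ⟨hi, hj⟩
  · exact h
  · by_contra hne
    have hb0 := h0 i hi
    have e1 := h1 i ⟨1, by omega⟩ (by simp [hi])
    have := two_le_degree (fun h => by
      have := congrArg Fin.val (f.injective h)
      simp at this
      omega) e1 hadj
    rw [hb0] at this
    omega

/-! ### Independence numbers of paths and cycles -/

theorem indepNum_eq {V : Type*} [Finite V] {G : SimpleGraph V} {k : ℕ} (S : Finset V)
    (hS : G.IsIndepSet S) (hk : S.card = k)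
    (hle : ∀ T : Finset V, G.IsIndepSet T → T.card ≤ k) : G.indepNum = k := by
  refine le_antisymm ?_ (hk ▸ hS.card_le_indepNum)
  obtain ⟨T, hT⟩ := G.exists_isNIndepSet_indepNum
  rw [← hT.card_eq]
  exact hle T hT.isIndepSet

theorem indepNum_le_of_iso {V W : Type*} [Finite V] [Finite W] {G : SimpleGraph V}
    {H : SimpleGraph W} (e : G ≃g H) : G.indepNum ≤ H.indepNum := by
  obtain ⟨T, hT⟩ := G.exists_isNIndepSet_indepNum
  rw [← hT.card_eq, ← Finset.card_map e.toEquiv.toEmbedding]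
  refine SimpleGraph.IsIndepSet.card_le_indepNum ?_
  intro x hx y hy hxy
  simp only [Finset.coe_map, Set.mem_image, Finset.mem_coe] at hx hy
  obtain ⟨x, hx, rfl⟩ := hx
  obtain ⟨y, hy, rfl⟩ := hy
  intro h
  exact hT.isIndepSet hx hy (fun h => hxy (by rw [h])) (e.map_adj_iff.1 h)

theorem indepNum_iso {V W : Type*} [Finite V] [Finite W] {G : SimpleGraph V}
    {H : SimpleGraph W} (e : G ≃g H) : G.indepNum = H.indepNum :=
  le_antisymm (indepNum_le_of_iso e) (indepNum_le_of_iso e.symm)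

/-- A map to `Fin k` which separates nonadjacent vertices bounds independent sets by `k`. -/
theorem IsIndepSet.card_le_of_map {V : Type*} {G : SimpleGraph V} {k : ℕ} (c : V → ℕ)
    (hc : ∀ v, c v < k) (h : ∀ v w, v ≠ w → c v = c w → G.Adj v w) {T : Finset V}
    (hT : G.IsIndepSet T) : T.card ≤ k := by
  rw [← Finset.card_range k]
  refine Finset.card_le_card_of_injOn c (fun v _ => by simp [hc]) ?_
  intro v hv w hw hvw
  by_contra hne
  exact hT hv hw hne (h v w hne hvw)

theorem isIndepSet_map {V W : Type*} {G : SimpleGraph V} [Fintype W] (f : W ↪ V)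
    (h : ∀ i j, ¬ G.Adj (f i) (f j)) : G.IsIndepSet (Finset.univ.map f : Finset V) := by
  intro x hx y hy _
  simp only [Finset.coe_map, Set.mem_image] at hx hy
  obtain ⟨i, -, rfl⟩ := hx
  obtain ⟨j, -, rfl⟩ := hy
  exact h i j

/-- Vertices with even index attain the value; the pairs {2j, 2j+1} form a clique cover giving the
bound. -/
theorem indepNum_pathGraph (n : ℕ) : (SimpleGraph.pathGraph n).indepNum = (n + 1) / 2 := by
  let f : Fin ((n + 1) / 2) ↪ Fin n :=
    ⟨fun i => ⟨2 * i.val, by omega⟩, fun i j h => by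
      simp only [Fin.mk.injEq] at h; exact Fin.ext (by omega)⟩
  have hf : ∀ i, (f i).val = 2 * i.val := fun _ => rfl
  refine indepNum_eq (Finset.univ.map f) (isIndepSet_map f ?_) (by simp) ?_
  · intro i j
    rw [SimpleGraph.pathGraph_adj]
    rw [hf, hf]
    omega
  · intro T hT
    refine IsIndepSet.card_le_of_map (fun v => v.val / 2) (fun v => by omega) ?_ hT
    intro v w hvw h
    have : v.val ≠ w.val := fun h => hvw (Fin.ext h)
    rw [SimpleGraph.pathGraph_adj]
    omega

/-- An independent set is disjoint from its rotation by one, so it has at most n/2 elements. -/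
theorem indepNum_cycleGraph {n : ℕ} (hn : 3 ≤ n) : (SimpleGraph.cycleGraph n).indepNum = n / 2 := by
  let f : Fin (n / 2) ↪ Fin n :=
    ⟨fun i => ⟨2 * i.val, by omega⟩, fun i j h => by
      simp only [Fin.mk.injEq] at h; exact Fin.ext (by omega)⟩
  have hf : ∀ i, (f i).val = 2 * i.val := fun _ => rfl
  refine indepNum_eq (Finset.univ.map f) (isIndepSet_map f ?_) (by simp) ?_
  · have key : ∀ i j, i < j → ¬ (SimpleGraph.cycleGraph n).Adj (f i) (f j) := by
      intro i j hij
      have h' : i.val < j.val := hij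
      rw [cycleGraph_adj_of_lt (Fin.lt_def.2 (by rw [hf, hf]; omega))]
      rw [hf, hf]
      omega
    intro i j
    rcases lt_trichotomy i j with h | rfl | h
    · exact key i j h
    · simp
    · exact fun h' => key j i h h'.symm
  · intro T hT
    have : NeZero n := ⟨by omega⟩
    have hd : Disjoint T (T.map (addRightEmbedding (1 : Fin n))) := by
      rw [Finset.disjoint_left]
      intro x hx hx'
      rw [Finset.mem_map] at hx'
      obtain ⟨y, hy, rfl⟩ := hx'
      have h1 : ((1 : Fin n)).val = 1 := by
        rw [Fin.val_one']; exact Nat.mod_eq_of_lt (by omega)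
      have hadj : (SimpleGraph.cycleGraph n).Adj (y + 1) y := by
        rw [SimpleGraph.cycleGraph_adj']
        left
        rw [add_sub_cancel_left, h1]
      exact hT hx hy hadj.ne hadj
    have := Finset.card_le_univ (T ∪ T.map (addRightEmbedding (1 : Fin n)))
    rw [Finset.card_union_of_disjoint hd, Finset.card_map, Fintype.card_fin] at this
    omega

/-! ### Test vectors on the path and the snake -/

theorem sum_fin_ite_eq {m : ℕ} (k : ℕ) (g : ℕ → ℝ) :
    (∑ j : Fin m, if k = j.val then g j.val else 0) = if k < m then g k else 0 := by
  split_ifs with h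
  · rw [Finset.sum_eq_single (⟨k, h⟩ : Fin m)]
    · simp
    · intro b _ hb
      rw [if_neg]
      rintro rfl
      exact hb rfl
    · simp
  · refine Finset.sum_eq_zero fun j _ => ?_
    rw [if_neg]
    have := j.isLt
    omega

theorem sum_fin_path {m : ℕ} (k : ℕ) (hk : k < m) (g : ℕ → ℝ) :
    (∑ j : Fin m, if k + 1 = j.val ∨ j.val + 1 = k then g j.val else 0) =
      (if k + 1 < m then g (k + 1) else 0) + if 1 ≤ k then g (k - 1) else 0 := by
  have h1 := sum_fin_ite_eq (m := m) (k + 1) g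
  -- The guard `1 ≤ k` kills the spurious term at k = 0, where k - 1 truncates to 0.
  have h2 := sum_fin_ite_eq (m := m) (k - 1) (fun j => if 1 ≤ k then g j else 0)
  rw [if_pos (by omega)] at h2
  rw [← h1, ← h2, ← Finset.sum_add_distrib]
  refine Finset.sum_congr rfl fun j _ => ?_
  split_ifs <;> first | omega | simp

/-- The terms u(0), ..., u(n-1) along the path satisfy the eigenvalue equation at every vertex but
the last, where the load is that of a pendant path on n-1 vertices. -/
theorem scaledIndex_pathGraph_lt {n : ℕ} {α : ℝ} (hα1 : α < 1) (hn : 2 ≤ n) {s t : ℝ}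
    (hs : s = α / (1 - α)) (hpos : ∀ j ≤ n - 1, 0 < pathSeq t s j)
    (hlt : pathLoad t s (n - 1) < t + 2 * s) :
    scaledIndex α (SimpleGraph.pathGraph n) < t + 2 * s := by
  have hconn : (SimpleGraph.pathGraph n).Connected := by
    obtain ⟨m, rfl⟩ : ∃ m, n = m + 1 := ⟨n - 1, by omega⟩
    exact SimpleGraph.pathGraph_connected m
  have hsum : ∀ k : Fin n, nbrSum (SimpleGraph.pathGraph n) s (fun j => pathSeq t s j.val) k =
      (if k.val + 1 < n then s * pathSeq t s k + pathSeq t s (k + 1) else 0) +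
        if 1 ≤ k.val then s * pathSeq t s k + pathSeq t s (k - 1) else 0 := by
    intro k
    rw [← sum_fin_path k.val k.isLt (fun j => s * pathSeq t s k + pathSeq t s j)]
    simp only [nbrSum, SimpleGraph.pathGraph_adj]
  have hlast : ∀ k : Fin n, ¬ k.val + 1 < n →
      nbrSum (SimpleGraph.pathGraph n) s (fun j => pathSeq t s j.val) k <
        (t + 2 * s) * pathSeq t s k := by
    intro k hk
    rw [hsum, if_neg hk, if_pos (by omega), zero_add]
    have hk' : n - 1 = k.val - 1 + 1 := by omega
    have p1 := hpos (k.val - 1 + 1) (by omega)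
    rw [hk', pathLoad] at hlt
    have : s + pathSeq t s (k.val - 1) / pathSeq t s (k.val - 1 + 1) =
      (s * pathSeq t s (k.val - 1 + 1) + pathSeq t s (k.val - 1)) / pathSeq t s (k.val - 1 + 1) := by
      field_simp
    rw [this, div_lt_iff₀ p1] at hlt
    rwa [Nat.sub_add_cancel (by omega)] at hlt
  have hle : ∀ k : Fin n, nbrSum (SimpleGraph.pathGraph n) s (fun j => pathSeq t s j.val) k ≤
      (t + 2 * s) * pathSeq t s k := by
    intro k
    by_cases hk : k.val + 1 < n
    · rw [hsum, if_pos hk]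
      rcases Nat.eq_zero_or_pos k.val with h | h
      · rw [h]
        simp [pathSeq]
        linarith
      · rw [if_pos (by omega)]
        obtain ⟨j, hj⟩ : ∃ j, k.val = j + 1 := ⟨k.val - 1, by omega⟩
        rw [hj, Nat.add_sub_cancel, show j + 1 + 1 = j + 2 from rfl, pathSeq_add_two]
        linarith
    · exact (hlast k hk).le
  subst hs
  exact (scaledIndex_le_of_super hα1 hconn (fun k => hpos k.val (by omega)) hle).2
    ⟨n - 1, by omega⟩ (hlast _ (by simp; omega))

section snake

variable {m : ℕ}

theorem tTree_adj_none_inl (i : Fin 1) : (tTree 1 1 m).Adj none (some (.inl i)) := by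
  simp [tTree]

theorem tTree_adj_none_mid (i : Fin 1) : (tTree 1 1 m).Adj none (some (.inr (.inl i))) := by
  simp [tTree]

theorem tTree_adj_none_inr (k : Fin m) :
    (tTree 1 1 m).Adj none (some (.inr (.inr k))) ↔ k.val = 0 := by
  simp [tTree]

theorem tTree_adj_inr_inr (j k : Fin m) :
    (tTree 1 1 m).Adj (some (.inr (.inr j))) (some (.inr (.inr k))) ↔
      j.val + 1 = k.val ∨ k.val + 1 = j.val := by
  simp only [tTree, SimpleGraph.fromRel_adj, ne_eq, Option.some.injEq, Sum.inr.injEq]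
  refine ⟨fun h => h.2, fun h => ⟨?_, h⟩⟩
  rintro rfl
  omega

theorem tTree_not_adj_inl (i : Fin 1) (z : Fin 1 ⊕ Fin 1 ⊕ Fin m) :
    ¬ (tTree 1 1 m).Adj (some (.inl i)) (some z) := by
  rcases z with z | z | z <;> simp [tTree]

theorem tTree_not_adj_mid (i : Fin 1) (z : Fin 1 ⊕ Fin 1 ⊕ Fin m) :
    ¬ (tTree 1 1 m).Adj (some (.inr (.inl i))) (some z) := by
  rcases z with z | z | z <;> simp [tTree]

theorem tTree_not_adj_inr_inl (k : Fin m) (i : Fin 1) :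
    ¬ (tTree 1 1 m).Adj (some (.inr (.inr k))) (some (.inl i)) :=
  fun h => tTree_not_adj_inl _ _ h.symm

theorem tTree_not_adj_inr_mid (k : Fin m) (i : Fin 1) :
    ¬ (tTree 1 1 m).Adj (some (.inr (.inr k))) (some (.inr (.inl i))) :=
  fun h => tTree_not_adj_mid _ _ h.symm

theorem tTree_connected : (tTree 1 1 m).Connected := by
  have key : ∀ v, (tTree 1 1 m).Reachable none v := by
    rintro (_ | i | i | k)
    · exact .refl _
    · exact (tTree_adj_none_inl i).reachable
    · exact (tTree_adj_none_mid i).reachable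
    · obtain ⟨k, hk⟩ := k
      induction k with
      | zero => exact ((tTree_adj_none_inr _).2 rfl).reachable
      | succ k ih =>
        refine (ih (by omega)).trans (SimpleGraph.Adj.reachable ?_)
        rw [tTree_adj_inr_inr]
        exact .inl rfl
  exact ⟨fun u v => (key u).symm.trans (key v)⟩

/-- Both single vertices and alternate vertices of the long arm are independent. For the bound, the
cliques are one single vertex, the other one with the centre, and k+1 cliques of at most two
vertices along the arm. -/
theorem indepNum_tTree (k : ℕ) : (tTree 1 1 (2 * k + 1)).indepNum = k + 3 := by
  let f : Fin 1 ⊕ Fin 1 ⊕ Fin (k + 1) ↪ Option (Fin 1 ⊕ Fin 1 ⊕ Fin (2 * k + 1)) :=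
    ⟨fun z => some (z.map id (Sum.map id fun i => ⟨2 * i.val, by omega⟩)), by
      rintro (i | i | i) (j | j | j) h <;> simp at h ⊢ <;> omega⟩
  refine indepNum_eq (Finset.univ.map f) (isIndepSet_map f ?_) ?_ ?_
  · rintro (i | i | i) y
    · exact tTree_not_adj_inl _ _
    · exact tTree_not_adj_mid _ _
    · rcases y with j | j | j
      · exact fun h => tTree_not_adj_inl _ _ h.symm
      · exact fun h => tTree_not_adj_mid _ _ h.symm
      · change ¬ (tTree 1 1 (2 * k + 1)).Adj (some (.inr (.inr _))) (some (.inr (.inr _)))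
        rw [tTree_adj_inr_inr]
        dsimp only
        omega
  · simp
    ring
  · intro T hT
    refine IsIndepSet.card_le_of_map (fun v => match v with
      | none => 1
      | some (.inl _) => 0
      | some (.inr (.inl _)) => 1
      | some (.inr (.inr j)) => 2 + j.val / 2) ?_ ?_ hT
    · rintro (_ | i | i | i) <;> dsimp only <;> omega
    · rintro (_ | i | i | i) (_ | j | j | j) hne h <;> dsimp only at h <;> try omega
      · exact absurd rfl hne
      · exact tTree_adj_none_mid j
      · exact absurd (by rw [Subsingleton.elim i j]) hne
      · exact (tTree_adj_none_mid i).symm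
      · exact absurd (by rw [Subsingleton.elim i j]) hne
      · rw [tTree_adj_inr_inr]
        have : i.val ≠ j.val := fun h => hne (by rw [Fin.ext h])
        omega

/-- The test vector runs through `pathSeq` from the far end of the long arm to the centre, and is
u(m+1)/u(1) on the two single vertices. The eigenvalue equation holds exactly away from the centre,
so only the load there matters. -/
theorem scaledIndex_snake_le {n : ℕ} {α : ℝ} (hα1 : α < 1) {H : SimpleGraph (Fin n)}
    (e : H ≃g tTree 1 1 (m + 1)) {s t : ℝ} (hs : s = α / (1 - α))
    (hpos : ∀ j ≤ m + 1, 0 < pathSeq t s j)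
    (hle : 2 * pathLoad t s 1 + pathLoad t s (m + 1) ≤ t + 2 * s) :
    scaledIndex α H ≤ t + 2 * s ∧
      (2 * pathLoad t s 1 + pathLoad t s (m + 1) < t + 2 * s → scaledIndex α H < t + 2 * s) := by
  have hconn : H.Connected := e.connected_iff.2 tTree_connected
  have p1 := hpos 1 (by omega)
  have pm := hpos (m + 1) le_rfl
  have hu1 : pathSeq t s 1 = t + s := rfl
  let y : Option (Fin 1 ⊕ Fin 1 ⊕ Fin (m + 1)) → ℝ := fun v => match v with
    | none => pathSeq t s (m + 1)
    | some (.inl _) => pathSeq t s (m + 1) / pathSeq t s 1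
    | some (.inr (.inl _)) => pathSeq t s (m + 1) / pathSeq t s 1
    | some (.inr (.inr j)) => pathSeq t s (m - j.val)
  have hy : ∀ v, 0 < y v := by
    rintro (_ | i | i | i)
    · exact pm
    · exact div_pos pm p1
    · exact div_pos pm p1
    · exact hpos _ (by omega)
  have hcentre : nbrSum (tTree 1 1 (m + 1)) s y none =
      (2 * pathLoad t s 1 + pathLoad t s (m + 1)) * y none := by
    have h0 := sum_fin_ite_eq (m := m + 1) 0
      (fun j => s * pathSeq t s (m + 1) + pathSeq t s (m - j))
    rw [if_pos (by omega)] at h0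
    simp only [nbrSum, Fintype.sum_option, Fintype.sum_sum_type, tTree_adj_none_inl,
      tTree_adj_none_mid, tTree_adj_none_inr, SimpleGraph.irrefl, if_true, if_false,
      Finset.univ_unique, Finset.sum_singleton, y]
    simp only [eq_comm (b := 0), h0, pathLoad]
    rw [show pathSeq t s 0 = 1 from rfl, zero_add, Nat.sub_zero]
    field_simp
    ring
  have hle' : ∀ v, nbrSum (tTree 1 1 (m + 1)) s y v ≤ (t + 2 * s) * y v := by
    rintro (_ | i | i | i)
    · rw [hcentre]
      exact mul_le_mul_of_nonneg_right hle pm.le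
    · simp only [nbrSum, Fintype.sum_option, (tTree_adj_none_inl _).symm, tTree_not_adj_inl,
        if_true, if_false, Finset.sum_const_zero, y]
      refine le_of_eq ?_
      field_simp
      rw [hu1]
      ring
    · simp only [nbrSum, Fintype.sum_option, (tTree_adj_none_mid _).symm, tTree_not_adj_mid,
        if_true, if_false, Finset.sum_const_zero, y]
      refine le_of_eq ?_
      field_simp
      rw [hu1]
      ring
    · have h0 := sum_fin_path i.val i.isLt
        (fun j => s * pathSeq t s (m - i) + pathSeq t s (m - j))
      simp only [nbrSum, Fintype.sum_option, Fintype.sum_sum_type,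
        SimpleGraph.adj_comm _ _ none, tTree_adj_none_inr, tTree_not_adj_inr_inl,
        tTree_not_adj_inr_mid, tTree_adj_inr_inr,
        if_false, Finset.sum_const_zero, zero_add, h0, y]
      refine le_of_eq ?_
      have hi := i.isLt
      rcases Nat.eq_zero_or_pos i.val with h | h
      · rw [h]
        rcases Nat.eq_zero_or_pos m with h' | h'
        · subst h'
          simp [pathSeq]
          ring
        · obtain ⟨q, rfl⟩ : ∃ q, m = q + 1 := ⟨m - 1, by omega⟩
          simp [pathSeq_add_two]
          ring
      · rw [if_neg (by omega), if_pos (by omega : 1 ≤ i.val)]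
        by_cases h' : i.val = m
        · rw [if_neg (by omega), show m - i.val = 0 by omega, show m - (i.val - 1) = 1 by omega]
          simp [pathSeq]
          ring
        · obtain ⟨q, hq⟩ : ∃ q, m - i.val = q + 1 := ⟨m - i.val - 1, by omega⟩
          rw [if_pos (by omega), hq, show m - (i.val + 1) = q by omega,
            show m - (i.val - 1) = q + 2 by omega, pathSeq_add_two]
          ring
  subst hs
  have := scaledIndex_le_of_super hα1 hconn (y := y ∘ e) (fun u => hy _)
    (fun u => by rw [nbrSum_iso]; exact hle' _)
  refine ⟨this.1, fun hlt => this.2 (e.symm none) ?_⟩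
  rw [nbrSum_iso, Function.comp_apply, RelIso.apply_symm_apply, hcentre]
  exact mul_lt_mul_of_pos_right hlt pm

open Classical in
/-- Recognition of the snake. -/
theorem nonempty_iso_snake {V : Type*} [Fintype V] {G : SimpleGraph V} (hG : G.Connected)
    (hcard : Fintype.card V = m + 4) {v a b : V} (hdeg : ∀ u, u ≠ v → G.degree u ≤ 2)
    (hv : G.degree v = 3) (hab : a ≠ b) (ha : G.Adj v a) (hb : G.Adj v b)
    (hda : G.degree a ≤ 1) (hdb : G.degree b ≤ 1) : Nonempty (G ≃g tTree 1 1 (m + 1)) := by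
  have hleaf : ∀ {w}, G.Adj v w → G.degree w ≤ 1 → ∀ y, G.Adj w y → y = v := by
    intro w hw hd y hy
    by_contra hne
    have := two_le_degree hne hy hw.symm
    omega
  have hda1 : G.degree a = 1 := by
    have := (G.degree_pos_iff_exists_adj a).2 ⟨v, ha.symm⟩
    omega
  -- Without the leaf a, the graph is connected of maximum degree at most two with b pendant: a path
  -- starting at b, whose second vertex is v.
  have hconn := hG.induce_compl_singleton_of_degree_eq_one hda1
  have hdegle : ∀ u : ({a}ᶜ : Set V), (G.induce ({a}ᶜ : Set V)).degree u ≤ G.degree u.val := by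
    intro u
    rw [← SimpleGraph.card_neighborFinset_eq_degree, ← SimpleGraph.card_neighborFinset_eq_degree]
    refine Finset.card_le_card_of_injOn Subtype.val ?_ Subtype.val_injective.injOn
    intro y hy
    simpa using hy
  have hv2 : ∀ hva, (G.induce ({a}ᶜ : Set V)).degree ⟨v, hva⟩ ≤ 2 := by
    intro hva
    have : (G.induce ({a}ᶜ : Set V)).degree ⟨v, hva⟩ ≤ ((G.neighborFinset v).erase a).card := by
      rw [← SimpleGraph.card_neighborFinset_eq_degree]
      refine Finset.card_le_card_of_injOn Subtype.val ?_ Subtype.val_injective.injOn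
      intro y hy
      have := y.2
      simp only [Set.mem_compl_iff, Set.mem_singleton_iff] at this
      simpa [this] using hy
    rw [Finset.card_erase_of_mem (by simpa using ha),
      SimpleGraph.card_neighborFinset_eq_degree, hv] at this
    exact this
  obtain ⟨e, he⟩ := exists_path_iso_of_leaf hconn (b := ⟨b, by simpa using hab.symm⟩)
    (fun u => by
      by_cases huv : u.val = v
      · obtain ⟨u, hu⟩ := u
        dsimp only at huv
        subst huv
        exact hv2 hu
      · exact (hdegle u).trans (hdeg _ huv)) ((hdegle _).trans hdb)
  have hc : Fintype.card ({a}ᶜ : Set V) = m + 3 := by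
    rw [Fintype.card_compl_set, hcard]
    simp
  have key : ∃ f : Fin (m + 3) → V, Function.Injective f ∧ (∀ i, f i ≠ a) ∧
      (∀ i j, G.Adj (f i) (f j) ↔ i.val + 1 = j.val ∨ j.val + 1 = i.val) ∧
      ∀ i, i.val = 0 → f i = b := by
    rw [← hc]
    refine ⟨fun i => (e i).val, fun i j h => e.injective (Subtype.ext h), fun i => (e i).2,
      fun i j => ?_, fun i hi => congrArg Subtype.val (he i hi)⟩
    rw [← SimpleGraph.pathGraph_adj, ← e.map_adj_iff, SimpleGraph.comap_adj]
    rfl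
  obtain ⟨f, hinj, hfa, hadj, hf0⟩ := key
  replace hf0 := hf0 0 rfl
  have hf1 : f 1 = v := by
    refine hleaf hb hdb _ ?_
    rw [← hf0, hadj]
    exact .inl rfl
  let F : Option (Fin 1 ⊕ Fin 1 ⊕ Fin (m + 1)) → V := fun x => match x with
    | none => f 1
    | some (.inl _) => a
    | some (.inr (.inl _)) => f 0
    | some (.inr (.inr k)) => f ⟨k.val + 2, by omega⟩
  have hF : Function.Injective F := by
    rintro (_ | i | i | i) (_ | j | j | j) h <;> dsimp only [F] at h
    any_goals first
      | rfl
      | exact absurd h (hfa _)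
      | exact absurd h.symm (hfa _)
      | rw [Subsingleton.elim i j]
    all_goals
      have := congrArg Fin.val (hinj h)
      simp at this
    rw [Fin.ext this]
  have hbij : Function.Bijective F :=
    (Fintype.bijective_iff_injective_and_card F).2 ⟨hF, by
      rw [hcard]; simp; ring⟩
  have hnb : ∀ x, G.Adj a x ↔ x = v := fun x => ⟨hleaf ha hda x, fun h => h ▸ ha.symm⟩
  have hv1 : ∀ i, f i = v ↔ i = 1 := fun i => by rw [← hf1]; exact hinj.eq_iff
  have hnone : ∀ x, G.Adj (F none) (F x) ↔ (tTree 1 1 (m + 1)).Adj none x := by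
    rintro (_ | j | j | j)
    · simp
    · simp only [F, tTree_adj_none_inl, hf1, ha]
    · simp only [F, tTree_adj_none_mid, iff_true, hadj]
      simp
    · rw [tTree_adj_none_inr]
      simp only [F, hadj]
      simp
  refine ⟨(⟨Equiv.ofBijective F hbij, ?_⟩ : tTree 1 1 (m + 1) ≃g G).symm⟩
  intro x y
  simp only [Equiv.ofBijective_apply]
  rcases x with _ | i | i | i
  · exact hnone y
  · rcases y with _ | y
    · rw [G.adj_comm, (tTree _ _ _).adj_comm]; exact hnone (some (.inl i))
    · refine iff_of_false ?_ (tTree_not_adj_inl _ _)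
      change ¬ G.Adj a _
      rw [hnb, ← hf1]
      exact fun h => by cases hF (a₁ := some y) (a₂ := none) h
  · rcases y with _ | y
    · rw [G.adj_comm, (tTree _ _ _).adj_comm]; exact hnone (some (.inr (.inl i)))
    · refine iff_of_false ?_ (tTree_not_adj_mid _ _)
      intro h
      have : F (some y) = v := hleaf hb hdb _ (hf0 ▸ h)
      rw [← hf1] at this
      cases hF (a₁ := some y) (a₂ := none) this
  · rcases y with _ | j | j | j
    · rw [G.adj_comm, (tTree _ _ _).adj_comm]; exact hnone (some (.inr (.inr i)))
    · refine iff_of_false ?_ fun h => tTree_not_adj_inl _ _ h.symm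
      intro h
      have := (hnb _).1 h.symm
      rw [← hf1] at this
      cases hF (a₁ := some (.inr (.inr i))) (a₂ := none) this
    · refine iff_of_false ?_ fun h => tTree_not_adj_mid _ _ h.symm
      intro h
      have : F (some (.inr (.inr i))) = v := hleaf hb hdb _ (hf0 ▸ h.symm)
      rw [← hf1] at this
      cases hF (a₁ := some (.inr (.inr i))) (a₂ := none) this
    · rw [tTree_adj_inr_inr]
      simp only [F, hadj]
      omega

end snake

/-! ### Comparing the path, the snake and the cycle with other graphs -/

open Classical in
theorem exists_perron_load {n : ℕ} {α : ℝ} (hα1 : α < 1) {G : SimpleGraph (Fin n)}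
    (hG : G.Connected) : ∃ x : Fin n → ℝ, (∀ u, 0 < x u) ∧
      ∀ u, load G (α / (1 - α)) x Finset.univ u = scaledIndex α G := by
  obtain ⟨x, hx, hxe⟩ := exists_perron hα1 hG
  refine ⟨x, hx, fun u => ?_⟩
  rw [eq_comm, ← mul_left_inj' (hx u).ne', ← hxe u, load, nbrSum, Finset.sum_mul,
    ← Finset.sum_filter]
  refine Finset.sum_congr rfl fun z _ => ?_
  have := (hx u).ne'
  field_simp

open Classical in
/-- Among connected graphs with a vertex of degree at least three, the snake has the least index,
and the path has an even smaller one. -/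
theorem snake_minimal {n : ℕ} {α : ℝ} (hα0 : 0 ≤ α) (hα1 : α < 1) {G : SimpleGraph (Fin n)}
    (hG : G.Connected) {v : Fin n} (hv : 3 ≤ G.degree v) :
    scaledIndex α (SimpleGraph.pathGraph n) < scaledIndex α G ∧
      ∀ H : SimpleGraph (Fin n), Nonempty (H ≃g snake n) → scaledIndex α H ≤ scaledIndex α G ∧
        (scaledIndex α G ≤ scaledIndex α H → Nonempty (G ≃g snake n)) := by
  obtain ⟨x, hx, hxe⟩ := exists_perron_load hα1 hG
  have hs : 0 ≤ α / (1 - α) := div_nonneg hα0 (by linarith)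
  set s := α / (1 - α) with hsdef
  -- The budget t + 2s is the scaled index of G itself; the test vectors on the path and the snake
  -- use the same t.
  obtain ⟨t, ht⟩ : ∃ t, scaledIndex α G = t + 2 * s := ⟨scaledIndex α G - 2 * s, by ring⟩
  rw [ht] at hxe ⊢
  obtain ⟨m, hm, hpos, hle, heq⟩ := snake_load_le hG hs hx (fun u => (hxe u).le) hv
  rw [Fintype.card_fin] at hm
  have hg1 : 0 < pathLoad t s 1 :=
    add_pos_of_nonneg_of_pos hs (div_pos (hpos 0 (by omega)) (hpos 1 (by omega)))
  constructor
  -- Joining the arms 1, 1, m+1 end to end gives n-1 vertices and a strictly smaller load.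
  · have p1 : ∀ j ≤ 1, 0 < pathSeq t s j := fun j hj => hpos j (by omega)
    obtain ⟨q1, -, r1⟩ := pathLoad_add t s hs 1 (m + 1) p1 hpos (by linarith)
    have r1 := r1 (by omega) (by omega)
    obtain ⟨q2, -, r2⟩ := pathLoad_add t s hs 1 (1 + (m + 1)) p1 q1 (by linarith)
    have r2 := r2 (by omega) (by omega)
    have hn : n - 1 = 1 + (1 + (m + 1)) := by omega
    exact scaledIndex_pathGraph_lt hα1 (by omega) hsdef (by rw [hn]; exact q2)
      (by rw [hn]; linarith)
  · rintro H ⟨e⟩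
    have hn : n - 3 = m + 1 := by omega
    rw [snake, hn] at e
    obtain ⟨h1, h2⟩ := scaledIndex_snake_le hα1 e hsdef hpos hle
    refine ⟨h1, fun hge => ?_⟩
    rw [snake, hn]
    rcases hle.lt_or_eq with hlt | hE
    · exact absurd (h2 hlt) (not_lt.2 hge)
    · obtain ⟨hd, hv3, a, b, hab, ha, hb, hda, hdb⟩ := heq hE
      exact nonempty_iso_snake hG (by rw [Fintype.card_fin, hm]) hd hv3 hab ha hb hda hdb

/-- At t = 2, the value belonging to the cycle, the recurrence has the double root 1, so its
solutions are affine in k. -/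
theorem pathSeq_two (s : ℝ) (k : ℕ) : pathSeq 2 s k = 1 + k * (1 + s) := by
  induction k using Nat.strong_induction_on with
  | _ k ih =>
    rcases k with _ | _ | k
    · simp [pathSeq]
    · simp [pathSeq]; ring
    · rw [pathSeq_add_two, ih (k + 1) (by omega), ih k (by omega)]
      push_cast
      ring

theorem two_add_two_mul_eq {α : ℝ} (hα1 : α < 1) : 2 + 2 * (α / (1 - α)) = 2 / (1 - α) := by
  have : 1 - α ≠ 0 := by linarith
  field_simp
  ring

/-- At t = 2 the sequence increases, so the load at the last vertex is at most s + 1 < 2 + 2s. -/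
theorem scaledIndex_pathGraph_lt_two {n : ℕ} {α : ℝ} (hα0 : 0 ≤ α) (hα1 : α < 1) (hn : 2 ≤ n) :
    scaledIndex α (SimpleGraph.pathGraph n) < 2 / (1 - α) := by
  have hs : 0 ≤ α / (1 - α) := div_nonneg hα0 (by linarith)
  rw [← two_add_two_mul_eq hα1]
  refine scaledIndex_pathGraph_lt hα1 hn rfl (fun j _ => ?_) ?_
  · rw [pathSeq_two]; positivity
  · obtain ⟨m, hm⟩ : ∃ m, n - 1 = m + 1 := ⟨n - 2, by omega⟩
    rw [hm, pathLoad, pathSeq_two, pathSeq_two]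
    set s := α / (1 - α)
    have : (1 + m * (1 + s)) / (1 + ((m + 1 : ℕ) : ℝ) * (1 + s)) ≤ 1 := by
      rw [div_le_one (by positivity)]
      push_cast
      nlinarith
    linarith

theorem scaledIndex_eq_of_cycle {n : ℕ} {α : ℝ} (hα1 : α < 1) (hn : 3 ≤ n)
    {G : SimpleGraph (Fin n)} (e : SimpleGraph.cycleGraph n ≃g G) :
    scaledIndex α G = 2 / (1 - α) := by
  classical
  have h1 : 0 < 1 - α := by linarith
  obtain ⟨m, rfl⟩ : ∃ m, n = m + 3 := ⟨n - 3, by omega⟩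
  have hconn : (SimpleGraph.cycleGraph (m + 3)).Connected := SimpleGraph.cycleGraph_connected
  rw [← scaledIndex_iso hα1 hconn e]
  have hdeg : ∀ (u : Fin (m + 3)) (_ : Fintype ((SimpleGraph.cycleGraph (m + 3)).neighborSet u)),
      (SimpleGraph.cycleGraph (m + 3)).degree u = 2 := fun u _ => by
    convert SimpleGraph.cycleGraph_degree_three_le (v := u)
  refine le_antisymm ?_ (le_scaledIndex_of_sum_degree hα1 hconn ?_).1
  · refine (scaledIndex_le_of_super hα1 hconn (y := fun _ => 1) (fun _ => one_pos) fun u => ?_).1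
    rw [nbrSum_one, hdeg, ← two_add_two_mul_eq hα1]
    refine le_of_eq ?_
    push_cast
    ring
  · simp only [hdeg, Finset.sum_const, Finset.card_univ, Fintype.card_fin, smul_eq_mul]
    omega

/-- The path has the least index among all connected graphs. -/
theorem path_minimal {n : ℕ} {α : ℝ} (hα0 : 0 ≤ α) (hα1 : α < 1) {G : SimpleGraph (Fin n)}
    (hG : G.Connected) : scaledIndex α (SimpleGraph.pathGraph n) ≤ scaledIndex α G ∧
      (scaledIndex α G ≤ scaledIndex α (SimpleGraph.pathGraph n) →
        Nonempty (G ≃g SimpleGraph.pathGraph n)) := by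
  classical
  have of_lt : scaledIndex α (SimpleGraph.pathGraph n) < scaledIndex α G →
      scaledIndex α (SimpleGraph.pathGraph n) ≤ scaledIndex α G ∧
      (scaledIndex α G ≤ scaledIndex α (SimpleGraph.pathGraph n) →
        Nonempty (G ≃g SimpleGraph.pathGraph n)) := fun h =>
    ⟨h.le, fun h' => absurd h (not_lt.2 h')⟩
  by_cases h : ∃ v, 3 ≤ G.degree v
  · obtain ⟨v, hv⟩ := h
    exact of_lt (snake_minimal hα0 hα1 hG hv).1
  · push Not at h
    have := path_or_cycle hG (fun u => by have := h u; omega)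
    rw [Fintype.card_fin] at this
    rcases this with ⟨⟨e⟩⟩ | ⟨h3, ⟨e⟩⟩
    · exact ⟨(scaledIndex_iso hα1 hG e.symm).ge, fun _ => ⟨e.symm⟩⟩
    · refine of_lt ?_
      rw [scaledIndex_eq_of_cycle hα1 h3 e]
      exact scaledIndex_pathGraph_lt_two hα0 hα1 (by omega)

/-- Both colour classes of a proper 2-colouring are independent. -/
theorem le_indepNum_of_isTree {n : ℕ} {G : SimpleGraph (Fin n)} (hG : G.IsTree) :
    n ≤ 2 * G.indepNum := by
  classical
  obtain ⟨C⟩ := hG.colorable_two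
  have key : ∀ c, (Finset.univ.filter fun v => C v = c).card ≤ G.indepNum := fun c => by
    refine SimpleGraph.IsIndepSet.card_le_indepNum ?_
    intro x hx y hy _ hadj
    simp only [Finset.coe_filter, Finset.mem_univ, true_and, Set.mem_ofPred_eq] at hx hy
    exact C.valid hadj (hx.trans hy.symm)
  have h := Finset.card_eq_sum_card_fiberwise (s := (Finset.univ : Finset (Fin n)))
    (t := Finset.univ) (f := C) (fun _ _ => by simp)
  rw [Finset.card_univ, Fintype.card_fin, Fin.sum_univ_two] at h
  have h0 := key 0
  have h1 := key 1
  omega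

open Classical in
theorem le_sum_degree_of_not_isTree {n : ℕ} {G : SimpleGraph (Fin n)} (hG : G.Connected)
    (hT : ¬ G.IsTree) : 2 * n ≤ ∑ u, G.degree u := by
  rw [G.sum_degrees_eq_twice_card_edges]
  have h1 := hG.card_vert_le_card_edgeSet_add_one
  rw [SimpleGraph.isTree_iff_connected_and_card] at hT
  have h2 : Nat.card G.edgeSet + 1 ≠ Nat.card (Fin n) := fun h => hT ⟨hG, h⟩
  rw [Nat.card_eq_fintype_card (α := G.edgeSet), ← SimpleGraph.edgeFinset_card,
    Nat.card_eq_fintype_card, Fintype.card_fin] at h1 h2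
  omega

/-! ### From index comparisons to the minimizers -/

theorem mem_graphClass_of_iso {n i : ℕ} {G H : SimpleGraph (Fin n)} (e : G ≃g H)
    (h : H ∈ graphClass n i) : G ∈ graphClass n i :=
  ⟨e.connected_iff.2 h.1, (indepNum_iso e).trans h.2⟩

/-- The model P may live on any vertex type, as the snake and the star do; the index is taken on its
copy P₀ on `Fin n`. -/
theorem isMinimizer_iff {n i : ℕ} {α : ℝ} (hα1 : α < 1) {W : Type*} {P : SimpleGraph W}
    {P₀ : SimpleGraph (Fin n)} (e : P₀ ≃g P) (hP : P₀ ∈ graphClass n i)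
    (hmin : ∀ H ∈ graphClass n i, scaledIndex α P₀ ≤ scaledIndex α H ∧
      (scaledIndex α H ≤ scaledIndex α P₀ → Nonempty (H ≃g P))) (G : SimpleGraph (Fin n)) :
    IsMinimizer α n i G ↔ Nonempty (G ≃g P) := by
  constructor
  · rintro ⟨hG, hle⟩
    exact (hmin G hG).2 ((aIndex_le_iff hα1).1 (hle _ hP))
  · rintro ⟨f⟩
    have f' : G ≃g P₀ := f.trans e.symm
    have hG := mem_graphClass_of_iso f' hP
    refine ⟨hG, fun H hH => (aIndex_le_iff hα1).2 ?_⟩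
    rw [scaledIndex_iso hα1 hG.1 f']
    exact (hmin H hH).1

theorem isMinimizer_iff_of_unique {n i : ℕ} {α : ℝ} (hα1 : α < 1) {W : Type*} {P : SimpleGraph W}
    {P₀ : SimpleGraph (Fin n)} (e : P₀ ≃g P) (hP : P₀ ∈ graphClass n i)
    (h : ∀ H ∈ graphClass n i, Nonempty (H ≃g P)) (G : SimpleGraph (Fin n)) :
    IsMinimizer α n i G ↔ Nonempty (G ≃g P) := by
  refine isMinimizer_iff hα1 e hP (fun H hH => ⟨?_, fun _ => h H hH⟩) G
  obtain ⟨f⟩ := h H hH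
  exact (scaledIndex_iso hα1 hP.1 (e.trans f.symm)).le

theorem isMinimizer_complete_iff {n : ℕ} (hn : 1 ≤ n) {α : ℝ} (hα1 : α < 1)
    (G : SimpleGraph (Fin n)) :
    IsMinimizer α n 1 G ↔ Nonempty (G ≃g (⊤ : SimpleGraph (Fin n))) := by
  have : Nonempty (Fin n) := ⟨⟨0, hn⟩⟩
  refine isMinimizer_iff_of_unique hα1 (SimpleGraph.Iso.refl (G := ⊤)) ⟨?_, ?_⟩ ?_ G
  · exact SimpleGraph.connected_top
  · refine indepNum_eq {⟨0, hn⟩} (by simp) (by simp) fun T hT => ?_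
    exact IsIndepSet.card_le_of_map (fun _ => 0) (by simp) (fun v w hvw _ => by simpa using hvw) hT
  · rintro H ⟨-, hH⟩
    have : H = ⊤ := by
      ext u v
      rw [SimpleGraph.top_adj]
      refine ⟨SimpleGraph.Adj.ne, fun huv => ?_⟩
      by_contra hadj
      have hS : H.IsIndepSet (({u, v} : Finset (Fin n)) : Set (Fin n)) := by
        intro x hx y hy hxy
        simp only [Finset.coe_insert, Finset.coe_singleton, Set.mem_insert_iff,
          Set.mem_singleton_iff] at hx hy
        rcases hx with rfl | rfl <;> rcases hy with rfl | rfl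
        · exact absurd rfl hxy
        · exact hadj
        · exact fun h => hadj h.symm
        · exact absurd rfl hxy
      have := hS.card_le_indepNum
      rw [Finset.card_pair huv, hH] at this
      omega
    exact ⟨this ▸ SimpleGraph.Iso.refl⟩

theorem isMinimizer_path_iff {n : ℕ} (hn : 1 ≤ n) {α : ℝ} (hα0 : 0 ≤ α) (hα1 : α < 1)
    (G : SimpleGraph (Fin n)) :
    IsMinimizer α n ((n + 1) / 2) G ↔ Nonempty (G ≃g SimpleGraph.pathGraph n) := by
  refine isMinimizer_iff hα1 SimpleGraph.Iso.refl ⟨?_, indepNum_pathGraph n⟩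
    (fun H hH => path_minimal hα0 hα1 hH.1) G
  obtain ⟨m, rfl⟩ : ∃ m, n = m + 1 := ⟨n - 1, by omega⟩
  exact SimpleGraph.pathGraph_connected m

/-- For odd n, 2⌊n/2⌋ < n rules out trees, so the degree-sum bound applies. Equality forces a
2-regular graph; the path is excluded by its independence number (n+1)/2. -/
theorem isMinimizer_cycle_iff {n : ℕ} (hn : 3 ≤ n) (hodd : Odd n) {α : ℝ} (hα1 : α < 1)
    (G : SimpleGraph (Fin n)) :
    IsMinimizer α n (n / 2) G ↔ Nonempty (G ≃g SimpleGraph.cycleGraph n) := by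
  classical
  obtain ⟨k, hk⟩ := hodd
  refine isMinimizer_iff hα1 SimpleGraph.Iso.refl ⟨?_, indepNum_cycleGraph hn⟩
    (fun H hH => ?_) G
  · obtain ⟨m, rfl⟩ : ∃ m, n = m + 1 := ⟨n - 1, by omega⟩
    exact SimpleGraph.cycleGraph_connected
  · rw [scaledIndex_eq_of_cycle hα1 hn SimpleGraph.Iso.refl]
    obtain ⟨hc, hi⟩ := hH
    have hT : ¬ H.IsTree := fun hT => by
      have := le_indepNum_of_isTree hT
      omega
    obtain ⟨h1, h2⟩ := le_scaledIndex_of_sum_degree hα1 hc (le_sum_degree_of_not_isTree hc hT)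
    refine ⟨h1, fun hle => ?_⟩
    have := path_or_cycle hc (fun u => (h2 hle u).le)
    rw [Fintype.card_fin] at this
    rcases this with ⟨⟨e⟩⟩ | ⟨-, ⟨e⟩⟩
    · have := indepNum_iso e
      rw [indepNum_pathGraph, hi] at this
      omega
    · exact ⟨e.symm⟩

theorem isMinimizer_snake_iff {n : ℕ} (hn : 4 ≤ n) (heven : Even n) {α : ℝ} (hα0 : 0 ≤ α)
    (hα1 : α < 1) (G : SimpleGraph (Fin n)) :
    IsMinimizer α n (n / 2 + 1) G ↔ Nonempty (G ≃g snake n) := by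
  classical
  obtain ⟨k, hk⟩ := heven
  have hcard : Fintype.card (Option (Fin 1 ⊕ Fin 1 ⊕ Fin (n - 3))) = n := by
    simp; omega
  let e : (snake n).overFin hcard ≃g snake n := ((snake n).overFinIso hcard).symm
  refine isMinimizer_iff hα1 e ⟨e.connected_iff.2 tTree_connected, ?_⟩ (fun H hH => ?_) G
  · rw [indepNum_iso e, snake, show n - 3 = 2 * (k - 2) + 1 by omega, indepNum_tTree]
    omega
  · obtain ⟨hc, hi⟩ := hH
    have hv : ∃ v, 3 ≤ H.degree v := by
      by_contra h
      push Not at h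
      have := path_or_cycle hc (fun u => by have := h u; omega)
      rw [Fintype.card_fin] at this
      rcases this with ⟨⟨f⟩⟩ | ⟨h3, ⟨f⟩⟩
      · have := indepNum_iso f
        rw [indepNum_pathGraph, hi] at this
        omega
      · have := indepNum_iso f
        rw [indepNum_cycleGraph h3, hi] at this
        omega
    obtain ⟨v, hv⟩ := hv
    exact (snake_minimal hα0 hα1 hc hv).2 _ ⟨e⟩

/-- A connected graph on `m + 1` vertices with `m` pairwise nonadjacent vertices is a star. -/
theorem nonempty_iso_star {m : ℕ} {H : SimpleGraph (Fin (m + 1))} (hc : H.Connected)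
    (hi : H.indepNum = m) (hm : 1 ≤ m) :
    Nonempty (H ≃g completeBipartiteGraph (Fin 1) (Fin m)) := by
  classical
  obtain ⟨S, hS⟩ := H.exists_isNIndepSet_indepNum
  have hSc : Sᶜ.card = 1 := by
    rw [Finset.card_compl, hS.card_eq, hi, Fintype.card_fin]
    omega
  obtain ⟨c, hc'⟩ := Finset.card_eq_one.1 hSc
  have hmem : ∀ x, x ≠ c → x ∈ S := by
    intro x hx
    by_contra hxS
    have : x ∈ Sᶜ := Finset.mem_compl.2 hxS
    rw [hc', Finset.mem_singleton] at this
    exact hx this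
  have hnon : ∀ x y, x ≠ c → y ≠ c → ¬ H.Adj x y := fun x y hx hy hadj =>
    hS.isIndepSet (hmem x hx) (hmem y hy) hadj.ne hadj
  have hadj : ∀ x, x ≠ c → H.Adj c x := by
    intro x hx
    have : Nontrivial (Fin (m + 1)) := Fin.nontrivial_iff_two_le.2 (by omega)
    obtain ⟨y, hy⟩ := hc.preconnected.exists_adj_of_nontrivial x
    by_cases hyc : y = c
    · exact hyc ▸ hy.symm
    · exact absurd hy (hnon x y hx hyc)
  let F : Fin 1 ⊕ Fin m → Fin (m + 1) := Sum.elim (fun _ => c) c.succAbove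
  have hF : Function.Bijective F := by
    rw [Fintype.bijective_iff_injective_and_card]
    refine ⟨?_, by simp; ring⟩
    rintro (i | i) (j | j) h
    · rw [Subsingleton.elim i j]
    · exact absurd h.symm (c.succAbove_ne j)
    · exact absurd h (c.succAbove_ne i)
    · rw [Fin.succAbove_right_injective h]
  refine ⟨(⟨Equiv.ofBijective F hF, ?_⟩ : completeBipartiteGraph (Fin 1) (Fin m) ≃g H).symm⟩
  rintro (i | i) (j | j)
  · simp [F]
  · simpa [F] using hadj _ (c.succAbove_ne j)
  · simpa [F] using (hadj _ (c.succAbove_ne i)).symm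
  · simpa [F] using hnon _ _ (c.succAbove_ne i) (c.succAbove_ne j)

theorem isMinimizer_star_iff {m : ℕ} (hm : 1 ≤ m) {α : ℝ} (hα1 : α < 1)
    (G : SimpleGraph (Fin (m + 1))) :
    IsMinimizer α (m + 1) m G ↔ Nonempty (G ≃g completeBipartiteGraph (Fin 1) (Fin m)) := by
  classical
  have hcard : Fintype.card (Fin 1 ⊕ Fin m) = m + 1 := by simp; ring
  let e : (completeBipartiteGraph (Fin 1) (Fin m)).overFin hcard ≃g _ :=
    ((completeBipartiteGraph (Fin 1) (Fin m)).overFinIso hcard).symm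
  refine isMinimizer_iff_of_unique hα1 e ⟨e.connected_iff.2 ?_, ?_⟩
    (fun H hH => nonempty_iso_star hH.1 hH.2 hm) G
  · have hr : ∀ v, (completeBipartiteGraph (Fin 1) (Fin m)).Reachable (.inl 0) v := by
      rintro (i | i)
      · rw [Subsingleton.elim i 0]
      · exact SimpleGraph.Adj.reachable (by simp)
    have : Nonempty (Fin 1 ⊕ Fin m) := ⟨.inl 0⟩
    exact ⟨fun u v => (hr u).symm.trans (hr v)⟩
  · rw [indepNum_iso e]
    refine indepNum_eq (Finset.univ.map Function.Embedding.inr) (isIndepSet_map _ ?_) (by simp) ?_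
    · intro i j
      simp
    · intro T hT
      -- The centre shares a clique with leaf 0; every other leaf is alone.
      refine IsIndepSet.card_le_of_map (Sum.elim (fun _ => 0) Fin.val) ?_ ?_ hT
      · rintro (i | i) <;> simp
        omega
      · rintro (i | i) (j | j) hne h
        · exact absurd (by rw [Subsingleton.elim i j]) hne
        · simp
        · simp
        · exact absurd (by rw [Fin.ext h]) hne

theorem theorem1p1 (n i : ℕ) (hn : 1 ≤ n) (hi : 1 ≤ i) (α : ℝ) (hα0 : 0 ≤ α) (hα1 : α < 1) :
    (i = 1 → ∀ G : SimpleGraph (Fin n),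
      IsMinimizer α n i G ↔ Nonempty (G ≃g (⊤ : SimpleGraph (Fin n)))) ∧
    (i = n / 2 →
      (Even n → ∀ G : SimpleGraph (Fin n),
        IsMinimizer α n i G ↔ Nonempty (G ≃g SimpleGraph.pathGraph n)) ∧
      (Odd n → ∀ G : SimpleGraph (Fin n),
        IsMinimizer α n i G ↔ Nonempty (G ≃g SimpleGraph.cycleGraph n))) ∧
    (i = (n + 1) / 2 → ∀ G : SimpleGraph (Fin n),
      IsMinimizer α n i G ↔ Nonempty (G ≃g SimpleGraph.pathGraph n)) ∧
    (i = n / 2 + 1 → 9 ≤ n →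
      (Odd n → ∀ G : SimpleGraph (Fin n),
        IsMinimizer α n i G ↔ Nonempty (G ≃g SimpleGraph.pathGraph n)) ∧
      (Even n → ∀ G : SimpleGraph (Fin n),
        IsMinimizer α n i G ↔ Nonempty (G ≃g snake n))) ∧
    (i = n - 1 → ∀ G : SimpleGraph (Fin n),
      IsMinimizer α n i G ↔
        Nonempty (G ≃g completeBipartiteGraph (Fin 1) (Fin (n - 1)))) := by
  refine ⟨?_, fun h => ⟨fun he => ?_, fun ho => ?_⟩, ?_, fun h hn9 => ⟨fun ho => ?_, fun he => ?_⟩, ?_⟩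
  · rintro rfl
    exact isMinimizer_complete_iff hn hα1
  · obtain ⟨k, hk⟩ := he
    rw [h, show n / 2 = (n + 1) / 2 by omega]
    exact isMinimizer_path_iff hn hα0 hα1
  · subst h
    -- The hypothesis i ≥ 1 excludes n = 1, so an odd n is at least 3.
    exact isMinimizer_cycle_iff (by obtain ⟨k, hk⟩ := ho; omega) ho hα1
  · rintro rfl
    exact isMinimizer_path_iff hn hα0 hα1
  · obtain ⟨k, hk⟩ := ho
    rw [h, show n / 2 + 1 = (n + 1) / 2 by omega]
    exact isMinimizer_path_iff hn hα0 hα1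
  · subst h
    exact isMinimizer_snake_iff (by omega) he hα0 hα1
  · obtain ⟨m, rfl⟩ : ∃ m, n = m + 1 := ⟨n - 1, by omega⟩
    rintro rfl
    exact isMinimizer_star_iff hi hα1
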